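/- Let $\mathfrak g=\mathfrak{gl}(1|1)$ be the complex Lie superalgebra with even basis elements $E_{11},E_{22}$ and odd basis elements $E_{12},E_{21}$, and the supercommutator as bracket. Write $E_{ij}[r]=E_{ij}t^r$, and let $\mathfrak g[t]$ act on $\hat{\mathfrak g}_-=t^{-1}\mathfrak g[t^{-1}]\cong\mathfrak g[t,t^{-1}]/\mathfrak g[t]$ by the adjoint action, extended by superderivations to the symmetric (super)algebra $S(\hat{\mathfrak g}_-)$. Put $S(\hat{\mathfrak g}_-)^{\mathfrak g[t]}=\{P\in S(\hat{\mathfrak g}_-) : \mathfrak g[t]P=0\}$, and define $S(\mathfrak g)^{\mathfrak g}$ likewise for the adjoint action of $\mathfrak g$ on $S(\mathfrak g)$. Let $T$ be the even derivation of $S(\hat{\mathfrak g}_-)$ with $T E_{ij}[-r-1]=(r+1)E_{ij}[-r-2]$ for $r\ge 0$, let $\iota:S(\mathfrak g)\to S(\hat{\mathfrak g}_-)$ be the algebra embedding with $X\mapsto X[-1]$ for $X\in\mathfrak g$, and set $E_{ij}(z)=\sum_{r\ge0}E_{ij}[-r-1]z^r$. For $k\ge1$ and a $2\times2$ array $e=(e_{ij})$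 consider the expressions $$h_k(e)=e_{11}^{k-1}(e_{11}+e_{22})+(k-1)\,e_{11}^{k-2}e_{21}e_{12},\qquad b_k(e)=e_{22}^{k-1}(e_{11}+e_{22})-(k-1)\,e_{22}^{k-2}e_{21}e_{12},$$ $$s_k(e)=\operatorname{str}\begin{bmatrix}e_{11}&e_{12}\\-e_{21}&-e_{22}\end{bmatrix}^k,\qquad \operatorname{str}X=X_{11}-X_{22},$$ where the second terms of $h_1$ and $b_1$ are zero. **Theorem.** Let $(x_k)_{k\ge1}$ be any one of the three families $(h_k)$, $(b_k)$, $(s_k)$; write $x_k\in S(\mathfrak g)$ for its value at $e_{ij}=E_{ij}$ and $x_k(z)\in S(\hat{\mathfrak g}_-)[[z]]$ for its value at $e_{ij}=E_{ij}(z)$. Then: 1. the elements $x_k$, $k\ge1$, generate the algebra $S(\mathfrak g)^{\mathfrak g}$; 2. $x_k(z)=\sum_{r\ge0}\frac{T^r\iota(x_k)}{r!}z^r$ for all $k\ge1$; 3. the coefficients of the series $x_k(z)$, $k\ge1$, generate the algebra $S(\hat{\mathfrak g}_-)^{\mathfrak g[t]}$; equivalently, the elements $T^r\iota(x_k)$ with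 $k\ge1$, $r\ge0$ generate $S(\hat{\mathfrak g}_-)^{\mathfrak g[t]}$. Here "generate" means that the unital $\mathbb C$-subalgebra generated by the elements is equal to the stated algebra. -/

import Mathlib

namespace GL11

/-! ### Symmetric superalgebras and superderivations -/

/-- The Koszul sign `(-1)^(a*b)` of two parities. -/
noncomputable def koszul (a b : ZMod 2) : ℂ := if a = 1 ∧ b = 1 then -1 else 1

/-- The relations `x y = (-1)^(|x||y|) y x` of supercommutativity between the members of a
homogeneous basis `X` with parities `p`. -/
inductive SRel {X : Type} (p : X → ZMod 2) : FreeAlgebra ℂ X → FreeAlgebra ℂ X → Prop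
  | swap (x y : X) : SRel p (FreeAlgebra.ι ℂ x * FreeAlgebra.ι ℂ y)
      (koszul (p x) (p y) • (FreeAlgebra.ι ℂ y * FreeAlgebra.ι ℂ x))

/-- The symmetric superalgebra `S(V)` over `ℂ` of the superspace `V` with homogeneous basis `X`,
where `x : X` has parity `p x`: polynomial in the even and exterior in the odd basis vectors. -/
def SSym {X : Type} (p : X → ZMod 2) : Type := RingQuot (SRel p)

namespace SSym

variable {X Y : Type} {p : X → ZMod 2}

noncomputable instance : Ring (SSym p) := inferInstanceAs (Ring (RingQuot (SRel p)))

noncomputable instance : Algebra ℂ (SSym p) := inferInstanceAs (Algebra ℂ (RingQuot (SRel p)))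

/-- The quotient map from the free algebra on the basis. -/
noncomputable def mk (p : X → ZMod 2) : FreeAlgebra ℂ X →ₐ[ℂ] SSym p :=
  RingQuot.mkAlgHom ℂ (SRel p)

theorem mk_surjective : Function.Surjective (mk p) := RingQuot.mkAlgHom_surjective ℂ (SRel p)

/-- A basis vector of `V` as an element of `S(V)`. -/
noncomputable def ι (p : X → ZMod 2) (x : X) : SSym p :=
  mk p (FreeAlgebra.ι ℂ x)

theorem ι_mul_ι (x y : X) : ι p x * ι p y = koszul (p x) (p y) • (ι p y * ι p x) := by
  have h : mk p (FreeAlgebra.ι ℂ x * FreeAlgebra.ι ℂ y) =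
      mk p (koszul (p x) (p y) • (FreeAlgebra.ι ℂ y * FreeAlgebra.ι ℂ x)) :=
    RingQuot.mkAlgHom_rel ℂ (SRel.swap (p := p) x y)
  simpa [ι] using h

/-- The universal property: a map of the basis into an algebra, whose values supercommute,
extends to an algebra homomorphism. -/
noncomputable def lift {A : Type} [Ring A] [Algebra ℂ A] (f : X → A)
    (hf : ∀ x y, f x * f y = koszul (p x) (p y) • (f y * f x)) : SSym p →ₐ[ℂ] A :=
  RingQuot.liftAlgHom ℂ ⟨FreeAlgebra.lift ℂ f, by
    rintro _ _ ⟨x, y⟩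
    simpa using hf x y⟩

@[simp] theorem lift_ι {A : Type} [Ring A] [Algebra ℂ A] (f : X → A)
    (hf : ∀ x y, f x * f y = koszul (p x) (p y) • (f y * f x)) (x : X) :
    lift f hf (ι p x) = f x :=
  (RingQuot.liftAlgHom_mkAlgHom_apply ℂ _ _ _).trans (FreeAlgebra.lift_ι_apply f x)

theorem hom_ext {A : Type} [Ring A] [Algebra ℂ A] {f g : SSym p →ₐ[ℂ] A}
    (h : ∀ x, f (ι p x) = g (ι p x)) : f = g := by
  refine RingQuot.ringQuot_ext' ℂ (s := SRel p) f g ?_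
  apply FreeAlgebra.hom_ext
  funext x
  exact h x

/-- The automorphism multiplying an element of parity `a` by `(-1)^(q*a)`. -/
noncomputable def signAut (p : X → ZMod 2) (q : ZMod 2) : SSym p →ₐ[ℂ] SSym p :=
  lift (fun x => koszul q (p x) • ι p x) (fun x y => by
    simp only [smul_mul_smul_comm, ι_mul_ι x y, smul_smul]
    congr 1
    ring)

/-- The span of the basis vectors of parity `a`. -/
noncomputable def linearPart (p : X → ZMod 2) (a : ZMod 2) : Submodule ℂ (SSym p) :=
  Submodule.span ℂ (ι p '' {y | p y = a})

theorem linearPart_mul_ι {a : ZMod 2} {u : SSym p} (hu : u ∈ linearPart p a) (y : X) :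
    u * ι p y = koszul a (p y) • (ι p y * u) := by
  induction hu using Submodule.span_induction with
  | mem u hu =>
    obtain ⟨x, rfl, rfl⟩ := hu
    exact ι_mul_ι x y
  | zero => simp
  | add u v _ _ hu hv => rw [add_mul, hu, hv, mul_add, smul_add]
  | smul c u _ hu => rw [smul_mul_assoc, hu, mul_smul_comm, smul_comm]

/-- The algebra homomorphism `u ↦ [[(-1)^(q|u|) u, D u], [0, u]]` attached to a superderivation
`D` of parity `q`. -/
noncomputable def derMatrix (q : ZMod 2) (f : X → SSym p)
    (hf : ∀ x, f x ∈ linearPart p (p x + q)) :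
    SSym p →ₐ[ℂ] Matrix (Fin 2) (Fin 2) (SSym p) :=
  lift (fun x => !![signAut p q (ι p x), f x; 0, ι p x]) (fun x y => by
    have h2 : ∀ z : ZMod 2, z = 0 ∨ z = 1 := by decide
    have hx := linearPart_mul_ι (hf x) y
    have hy := linearPart_mul_ι (hf y) x
    have hxy := ι_mul_ι (p := p) x y
    simp only [signAut, lift_ι]
    ext i j
    fin_cases i <;> fin_cases j
    · simp [hxy, smul_smul]
      congr 1
      ring
    · simp [hx, hy]
      rcases h2 (p x) with h | h <;> rcases h2 (p y) with h' | h' <;>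
        rcases h2 q with h'' | h'' <;>
        simp [h, h', h'', koszul, show (1 : ZMod 2) + 1 = 0 from rfl, neg_smul, one_smul] <;>
        first | done | rw [add_comm]
    · simp
    · simp [hxy])

/-- The superderivation `D` of parity `q` of `S(V)` with prescribed values `f x` on the basis
vectors, where `f` extends to a linear endomorphism of parity `q` of `V`. -/
noncomputable def superDer (q : ZMod 2) (f : X → SSym p)
    (hf : ∀ x, f x ∈ linearPart p (p x + q)) : SSym p →ₗ[ℂ] SSym p where
  toFun u := derMatrix q f hf u 0 1
  map_add' u v := by simp
  map_smul' c u := by simp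

section der

variable (q : ZMod 2) (f : X → SSym p) (hf : ∀ x, f x ∈ linearPart p (p x + q))

@[simp] theorem superDer_ι (x : X) : superDer q f hf (ι p x) = f x := by
  simp [superDer, derMatrix]

@[simp] theorem superDer_algebraMap (c : ℂ) :
    superDer q f hf (algebraMap ℂ (SSym p) c) = 0 := by
  simp [superDer, Matrix.algebraMap_matrix_apply]

theorem derMatrix_diag (u : SSym p) : derMatrix q f hf u 1 0 = 0 ∧
    derMatrix q f hf u 0 0 = signAut p q u ∧ derMatrix q f hf u 1 1 = u := by
  obtain ⟨u, rfl⟩ := mk_surjective u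
  induction u using FreeAlgebra.induction with
  | grade0 r => simp [Matrix.algebraMap_matrix_apply]
  | grade1 x =>
    change derMatrix q f hf (ι p x) 1 0 = 0 ∧
      derMatrix q f hf (ι p x) 0 0 = signAut p q (ι p x) ∧ derMatrix q f hf (ι p x) 1 1 = ι p x
    simp [derMatrix]
  | mul a b ha hb =>
    simp only [map_mul, Matrix.mul_apply, Fin.sum_univ_two, ha, hb]
    simp
  | add a b ha hb => simp [ha, hb]

/-- The super Leibniz rule `D(uv) = D(u) v + (-1)^(|D||u|) u D(v)`. -/
theorem superDer_mul (u v : SSym p) :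
    superDer q f hf (u * v) = superDer q f hf u * v + signAut p q u * superDer q f hf v := by
  have h : superDer q f hf (u * v) = (derMatrix q f hf u * derMatrix q f hf v) 0 1 := by
    simp [superDer]
  rw [h, Matrix.mul_apply, Fin.sum_univ_two, (derMatrix_diag q f hf u).2.1,
    (derMatrix_diag q f hf v).2.2, add_comm]
  rfl

end der

/-- The subalgebra annihilated by a family of superderivations. -/
noncomputable def annihilated (q : Y → ZMod 2) (f : Y → X → SSym p)
    (hf : ∀ a x, f a x ∈ linearPart p (p x + q a)) : Subalgebra ℂ (SSym p) where
  carrier := {P | ∀ a, superDer (q a) (f a) (hf a) P = 0}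
  mul_mem' {u v} hu hv a := by rw [superDer_mul, hu a, hv a, zero_mul, mul_zero, add_zero]
  add_mem' {u v} hu hv a := by rw [map_add, hu a, hv a, add_zero]
  algebraMap_mem' c a := superDer_algebraMap _ _ _ c

end SSym

/-! ### The Lie superalgebra `gl(1|1)` and the invariants

The row and column indices `1, 2` are `0, 1 : Fin 2`. -/

/-- Parity of the matrix unit `E_ij`: the index `1` is even and `2` is odd. -/
def par (a : Fin 2 × Fin 2) : ZMod 2 := (a.1 : ℕ) + (a.2 : ℕ)

/-- The supercommutator `[E_ij, E_kl] = E_ij E_kl - (-1)^(|E_ij||E_kl|) E_kl E_ij` in `gl(1|1)`. -/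
noncomputable def bracket (a b : Fin 2 × Fin 2) : Matrix (Fin 2) (Fin 2) ℂ :=
  Matrix.single a.1 a.2 1 * Matrix.single b.1 b.2 1 -
    koszul (par a) (par b) • (Matrix.single b.1 b.2 1 * Matrix.single a.1 a.2 1)

theorem bracket_parity (a b c : Fin 2 × Fin 2) (h : par c ≠ par b + par a) :
    bracket a b c.1 c.2 = 0 := by
  obtain ⟨i, j⟩ := a
  obtain ⟨k, l⟩ := b
  obtain ⟨m, n⟩ := c
  revert h
  fin_cases i <;> fin_cases j <;> fin_cases k <;> fin_cases l <;> fin_cases m <;> fin_cases n <;>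
    simp [bracket, par, koszul, show (1 : ZMod 2) + 1 = 0 from rfl]

/-- The symmetric algebra `S(g)` of `g = gl(1|1)`. -/
abbrev Sg : Type := SSym par

/-- The parity of `E_ij[-r-1]`, which is encoded as `((i, j), r)`. -/
def parLoop (x : (Fin 2 × Fin 2) × ℕ) : ZMod 2 := par x.1

/-- The symmetric algebra of `t⁻¹ g[t⁻¹]`, with generators `E_ij[-r-1] = E_ij t^(-r-1)`. -/
abbrev SLoop : Type := SSym parLoop

/-- The adjoint action of `E_a` on a basis vector `E_b` of `g`. -/
noncomputable def adg (a b : Fin 2 × Fin 2) : Sg :=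
  ∑ c : Fin 2 × Fin 2, bracket a b c.1 c.2 • SSym.ι par c

theorem adg_mem (a b : Fin 2 × Fin 2) : adg a b ∈ SSym.linearPart par (par b + par a) := by
  refine Submodule.sum_mem _ fun c _ => ?_
  by_cases h : par c = par b + par a
  · exact Submodule.smul_mem _ _ (Submodule.subset_span ⟨c, h, rfl⟩)
  · rw [bracket_parity a b c h, zero_smul]
    exact Submodule.zero_mem _

/-- The algebra `S(g)^g` of `g`-invariants. -/
noncomputable def invg : Subalgebra ℂ Sg := SSym.annihilated par adg adg_mem

/-- The action of `E_a[s]`, where `s ≥ 0` and `a = (a, s)`, on the basis vector `E_b[-r-1]`,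
`x = (b, r)`, of `g[t,t⁻¹]/g[t]`: it is the class of `[E_a, E_b] t^(s-r-1)`, which vanishes
if `s > r`. -/
noncomputable def adLoop (a x : (Fin 2 × Fin 2) × ℕ) : SLoop :=
  if a.2 ≤ x.2 then
    ∑ c : Fin 2 × Fin 2, bracket a.1 x.1 c.1 c.2 • SSym.ι parLoop (c, x.2 - a.2)
  else 0

theorem adLoop_mem (a x : (Fin 2 × Fin 2) × ℕ) :
    adLoop a x ∈ SSym.linearPart parLoop (parLoop x + par a.1) := by
  unfold adLoop
  split_ifs
  · refine Submodule.sum_mem _ fun c _ => ?_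
    by_cases h : par c = par x.1 + par a.1
    · exact Submodule.smul_mem _ _ (Submodule.subset_span ⟨(c, x.2 - a.2), h, rfl⟩)
    · rw [bracket_parity a.1 x.1 c h, zero_smul]
      exact Submodule.zero_mem _
  · exact Submodule.zero_mem _

/-- The algebra of `g[t]`-invariants in the symmetric algebra of `g[t,t⁻¹]/g[t] = t⁻¹ g[t⁻¹]`. -/
noncomputable def invLoop : Subalgebra ℂ SLoop :=
  SSym.annihilated (p := parLoop) (fun a : (Fin 2 × Fin 2) × ℕ => par a.1) adLoop adLoop_mem

/-- The translation operator `T = -d/dt`: the even derivation with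
`T E_ij[-r-1] = (r+1) E_ij[-r-2]`. -/
noncomputable def T : SLoop →ₗ[ℂ] SLoop :=
  SSym.superDer (p := parLoop) 0 (fun x => ((x.2 : ℂ) + 1) • SSym.ι parLoop (x.1, x.2 + 1)) (fun x =>
    Submodule.smul_mem _ _ (Submodule.subset_span ⟨(x.1, x.2 + 1), (add_zero _).symm, rfl⟩))

/-- The embedding of `S(g)` into the symmetric algebra of `t⁻¹ g[t⁻¹]` with `X ↦ X[-1]`. -/
noncomputable def emb : Sg →ₐ[ℂ] SLoop :=
  SSym.lift (fun a => SSym.ι parLoop (a, 0)) (fun a b => SSym.ι_mul_ι (p := parLoop) (a, 0) (b, 0))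

/-! ### The three families -/

/-- The generators `E_ij` of `S(g)`. -/
noncomputable def E (i j : Fin 2) : Sg := SSym.ι par (i, j)

/-- The series `E_ij(z) = ∑ E_ij[-r-1] z^r`. -/
noncomputable def Eser (i j : Fin 2) : PowerSeries SLoop :=
  PowerSeries.mk fun r => SSym.ι parLoop ((i, j), r)

/-- Labels of the three families of invariants. -/
inductive Family
  | h
  | b
  | s

/-- The `k`-th member, `k ≥ 1`, of each family, as an expression in a `2 × 2` array `e` of ring
elements: `e₁₁^(k-1) (e₁₁+e₂₂) + (k-1) e₁₁^(k-2) e₂₁ e₁₂`,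
`e₂₂^(k-1) (e₁₁+e₂₂) - (k-1) e₂₂^(k-2) e₂₁ e₁₂`, and the supertrace of the `k`-th power of
the matrix `[[e₁₁, e₁₂], [-e₂₁, -e₂₂]]`. -/
def Family.expr {A : Type} [Ring A] (F : Family) (e : Fin 2 → Fin 2 → A) (k : ℕ) : A :=
  match F with
  | .h => e 0 0 ^ (k - 1) * (e 0 0 + e 1 1) + (k - 1 : ℕ) • (e 0 0 ^ (k - 2) * e 1 0 * e 0 1)
  | .b => e 1 1 ^ (k - 1) * (e 0 0 + e 1 1) - (k - 1 : ℕ) • (e 1 1 ^ (k - 2) * e 1 0 * e 0 1)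
  | .s => ((!![e 0 0, e 0 1; -e 1 0, -e 1 1]) ^ k) 0 0 - ((!![e 0 0, e 0 1; -e 1 0, -e 1 1]) ^ k) 1 1

end GL11

/-!
Write `E_11(z) = N(z)`, `E_11(z) + E_22(z) = C(z)`, and let `ψ⁺ = E_12(z)`, `ψ⁻ = E_21(z)`. The
series `C(z)` is invariant, and after inverting `C(z)` so is `H = N + ψ⁻ψ⁺ / C`. As `ψ⁻ψ⁺` has square
zero, `h_k(z) = C H^(k-1)`, `b_k(z) = C (C - H)^(k-1)` and `s_k(z) = H^k - (H - C)^k`. The three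
families are thus the values of one linear map, `twist : f ↦ C f(H)`, at the homogeneous polynomials
`X^(k-1)`, `(C - X)^(k-1)` and `(X^k - (X - C)^k) / C` in `X` and `C`. Their leading coefficients in
`X` are nonzero, so each family is triangular over the family `h` (`SuperArray.exists_expr_eq_sum`),
and it suffices to treat the latter.

Let `P` be an invariant of `g[t]`. Setting the odd generators to zero maps `P` to a polynomial in the
coefficients `N_r` and `C_r` (`restr`), and `h_k(z)` to `C(z) N(z)^(k-1)`. The odd currents act by
the vector fields `∑_b ± E_a[-b-1] ∂/∂N_(b+s) + C_b ∂/∂E_a'[-b-s-1]` (`act_eq_sum`). Two conclusions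
follow.

* `restr` is injective on invariants (`eq_zero_of_restr_eq_zero`): if all odd derivatives of `P` of
  order less than `k` vanish on the even part, then those of order `k` satisfy there the triangular
  systems `∑_b C_b q_(b+s) = 0`, and vanish, too.
* `restr P` satisfies the condition `∂P/∂N_s = ∑_b C_b Q_(b+s)` for all `s`, with polynomials
  `Q_r` (`FirstOrder`).

The core of the proof is that this condition forces a polynomial into the algebra generated by the
coefficients of the `C(z) N(z)^k` (`FirstOrder.mem_jetAlg`). Polarize the part of degree `n` in the
`C_r` to a tensor with polynomials in the `N_r` as coefficients, and let `x_k` be the operator which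
lowers the index of the `k`-th tensor factor. The condition says that the polarizations of the
`∂P/∂N_s` are power sums `∑_k x_k^s w_k`. Let `B` be the span of the tensors
`N(x_1)^κ_1 ⋯ N(x_n)^κ_n (C_{m_1} ⊗ ⋯ ⊗ C_{m_n})`, whose images under multiplication are the products
of coefficients of the `C(z) N(z)^κ`. The operators `x_k - x_l` map `B` onto itself, and therefore
power sums with values in `B` have coefficients `w_k` in `B` (`exists_powerSum`). By induction on the
degree in `N` the polarizations of the `∂P/∂N_s` lie in `B`; hence so does
`∑_s N_s ∑_k x_k^s w_k = ∑_k N(x_k) w_k`, which gives `P` up to the factor of Euler's formula.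

The coefficients of a series `f` with `T f = f'` are `T^r f_0 / r!`, and such series form a
subalgebra which contains the `E_ij(z)` (`translationSubalgebra`). Finally `S(g)` is a retract of
`S(t⁻¹ g[t⁻¹])` by setting the `E_ij[-r-1]` with `r > 0` to zero. An element of `S(g)` is invariant
if and only if its image in `S(t⁻¹ g[t⁻¹])` is (`mem_invg_iff`), and the retraction maps all
coefficients of the `x_k(z)` but the constant ones to zero (`retr_coeff_expr`). So the generators of
`S(g)^g` come from those of the loop algebra.
-/

namespace GL11

open MvPolynomial Filter

/-! ### Power sums of commuting operators -/

/-- A sequence of power sums `∑ k ∈ S, x k ^ s (w k)` lying in a submodule `B` on which the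
differences `x k - x l` are onto is a sequence of power sums of elements of `B`. The sequence
`u (s + 1) - x k₀ (u s)` is one of power sums without `k₀`, with `x k (w k) - x k₀ (w k)` in place of
`w k`; so one may induct on `S`, dividing by `x k - x k₀` and reading off `w k₀` from `u 0`. -/
theorem exists_powerSum {ι V : Type*} [DecidableEq ι] [AddCommGroup V] [Module ℂ V]
    (x : ι → Module.End ℂ V) (hx : ∀ k l, Commute (x k) (x l)) (B : Submodule ℂ V)
    (hB : ∀ k, ∀ b ∈ B, x k b ∈ B)
    (hdiv : ∀ k l, k ≠ l → ∀ b ∈ B, ∃ b' ∈ B, x k b' - x l b' = b)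
    (S : Finset ι) (u : ℕ → V) (hu : ∀ s, u s ∈ B) (w : ι → V)
    (huw : ∀ s, u s = ∑ k ∈ S, (x k ^ s) (w k)) :
    ∃ w' : ι → V, (∀ k, w' k ∈ B) ∧ ∀ s, u s = ∑ k ∈ S, (x k ^ s) (w' k) := by
  induction S using Finset.induction_on generalizing u w with
  | empty => exact ⟨0, fun _ => B.zero_mem, by simpa using huw⟩
  | insert k₀ S hk₀ ih =>
    have hpow : ∀ k s v, (x k ^ s) (x k₀ v) = x k₀ ((x k ^ s) v) := fun k s v =>
      LinearMap.congr_fun ((hx k k₀).pow_left s).eq v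
    obtain ⟨w₁, hw₁, hu₁⟩ := ih (fun s => u (s + 1) - x k₀ (u s))
      (fun s => B.sub_mem (hu _) (hB _ _ (hu _))) (fun k => x k (w k) - x k₀ (w k)) (by
        intro s
        simp only [huw, Finset.sum_insert hk₀, map_add, map_sum, map_sub, hpow, pow_succ,
          Module.End.mul_apply, Finset.sum_sub_distrib]
        abel)
    have hne : ∀ k ∈ S, k ≠ k₀ := fun k hk h => hk₀ (h ▸ hk)
    choose g hgB hg using fun k : {k // k ≠ k₀} => hdiv k k₀ k.2 (w₁ k) (hw₁ k)
    -- `w₂ k` solves `(x k - x k₀) (w₂ k) = w₁ k` for `k ≠ k₀`, and `w₂ k₀` makes the case `s = 0` true.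
    let w₂ : ι → V := fun k => if h : k ≠ k₀ then g ⟨k, h⟩ else u 0 - ∑ k ∈ S,
      if h : k ≠ k₀ then g ⟨k, h⟩ else 0
    have hgS : ∀ k ∈ S, w₂ k = if h : k ≠ k₀ then g ⟨k, h⟩ else 0 := fun k hk => by
      simp [w₂, hne k hk]
    have hw₂ : ∀ k ∈ S, x k (w₂ k) - x k₀ (w₂ k) = w₁ k := fun k hk => by
      have := hg ⟨k, hne k hk⟩
      simpa [hgS k hk, hne k hk] using this
    have h0 : w₂ k₀ = u 0 - ∑ k ∈ S, w₂ k := by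
      rw [Finset.sum_congr rfl hgS]
      simp [w₂]
    refine ⟨w₂, fun k => ?_, fun s => ?_⟩
    · by_cases h : k = k₀
      · subst h
        rw [h0]
        refine B.sub_mem (hu 0) (B.sum_mem fun l hl => ?_)
        rw [hgS l hl, dif_pos (hne l hl)]
        exact hgB _
      · simp only [w₂, dif_pos h]
        exact hgB _
    · rw [Finset.sum_insert hk₀]
      induction s with
      | zero => simp [h0]
      | succ s ihs =>
        have h1 : u (s + 1) = x k₀ (u s) + ∑ k ∈ S, (x k ^ s) (w₁ k) := by
          rw [← hu₁ s]; abel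
        rw [h1, ihs, Finset.sum_congr rfl fun k hk =>
          show (x k ^ s) (w₁ k) = (x k ^ s) (x k (w₂ k) - x k₀ (w₂ k)) by rw [hw₂ k hk]]
        simp only [map_add, map_sum, map_sub, hpow, pow_succ, Module.End.mul_apply,
          Finset.sum_sub_distrib]
        abel

/-! ### Tensors with polynomial coefficients -/

/-- The polynomial ring in the variables `N_r` (`Sum.inl r`) and `C_r` (`Sum.inr r`), `r ≥ 0`. -/
abbrev Jet : Type := MvPolynomial (ℕ ⊕ ℕ) ℂ

/-- `N(z) = ∑ N_r z^r`. -/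
noncomputable def Nser : PowerSeries Jet := PowerSeries.mk fun r => X (Sum.inl r)

/-- `C(z) = ∑ C_r z^r`. -/
noncomputable def Cser : PowerSeries Jet := PowerSeries.mk fun r => X (Sum.inr r)

/-- The operator `x_k` on functions of `n` indices, precomposition with raising the `k`-th index by
one. For a function viewed as the tensor `∑ f(i) C_{i_1} ⊗ ⋯ ⊗ C_{i_n}` it lowers the index of the
`k`-th factor. -/
noncomputable def sh {n : ℕ} (k : Fin n) : Module.End ℂ ((Fin n → ℕ) → Jet) :=
  LinearMap.funLeft ℂ Jet fun i => Function.update i k (i k + 1)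

theorem sh_apply {n : ℕ} (k : Fin n) (f : (Fin n → ℕ) → Jet) (i : Fin n → ℕ) :
    sh k f i = f (Function.update i k (i k + 1)) := rfl

theorem sh_pow_apply {n : ℕ} (k : Fin n) (s : ℕ) (f : (Fin n → ℕ) → Jet) (i : Fin n → ℕ) :
    (sh k ^ s) f i = f (Function.update i k (i k + s)) := by
  induction s generalizing f with
  | zero => simp
  | succ s ih =>
    rw [pow_succ, Module.End.mul_apply, ih, sh_apply]
    simp [add_assoc]

theorem sh_commute {n : ℕ} (k l : Fin n) : Commute (sh k) (sh l) := by
  by_cases h : k = l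
  · subst h; exact Commute.refl _
  · refine LinearMap.ext fun f => funext fun i => ?_
    simp only [Module.End.mul_apply, sh_apply, Function.update_of_ne h,
      Function.update_of_ne (Ne.symm h)]
    rw [Function.update_comm h]

/-- The coefficient of `z^(m-i)` in `N(z)^κ`, which is zero for `m < i`. -/
noncomputable def powCoeff (κ m i : ℕ) : Jet :=
  if i ≤ m then PowerSeries.coeff (m - i) (Nser ^ κ) else 0

theorem powCoeff_succ_succ (κ m i : ℕ) : powCoeff κ (m + 1) (i + 1) = powCoeff κ m i := by
  simp [powCoeff]

theorem powCoeff_of_lt {κ m i : ℕ} (h : m < i) : powCoeff κ m i = 0 := by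
  simp [powCoeff, h]

theorem powCoeff_zero (m i : ℕ) : powCoeff 0 m i = if i = m then 1 else 0 := by
  unfold powCoeff
  rcases lt_trichotomy i m with h | h | h
  · rw [if_pos h.le, if_neg h.ne, pow_zero, PowerSeries.coeff_one, if_neg (by omega)]
  · simp [h]
  · rw [if_neg (by omega), if_neg (by omega)]

theorem sum_X_mul_powCoeff {κ m L : ℕ} (hL : m < L) (i : ℕ) :
    ∑ s ∈ Finset.range L, X (Sum.inl s) * powCoeff κ m (i + s) = powCoeff (κ + 1) m i := by
  by_cases h : i ≤ m
  · rw [powCoeff, if_pos h, pow_succ', PowerSeries.coeff_mul,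
      Finset.Nat.sum_antidiagonal_eq_sum_range_succ_mk,
      ← Finset.sum_subset (Finset.range_mono (show (m - i).succ ≤ L by omega))]
    · refine Finset.sum_congr rfl fun s hs => ?_
      have hs' := Finset.mem_range.1 hs
      rw [powCoeff, if_pos (by omega), Nser, PowerSeries.coeff_mk, Nat.sub_sub]
    · intro s _ hs
      rw [powCoeff_of_lt (by rw [Finset.mem_range] at hs; omega), mul_zero]
  · rw [powCoeff_of_lt (by omega)]
    exact Finset.sum_eq_zero fun s _ => by rw [powCoeff_of_lt (by omega), mul_zero]

theorem sum_X_mul_powCoeff_inr {κ m L : ℕ} (hL : m < L) :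
    ∑ s ∈ Finset.range L, X (Sum.inr s) * powCoeff κ m s =
      PowerSeries.coeff m (Cser * Nser ^ κ) := by
  rw [PowerSeries.coeff_mul, Finset.Nat.sum_antidiagonal_eq_sum_range_succ_mk,
    ← Finset.sum_subset (Finset.range_mono (show m.succ ≤ L by omega))]
  · refine Finset.sum_congr rfl fun s hs => ?_
    have hs' := Finset.mem_range.1 hs
    rw [powCoeff, if_pos (by omega), Cser, PowerSeries.coeff_mk]
  · intro s _ hs
    rw [powCoeff_of_lt (by rw [Finset.mem_range] at hs; omega), mul_zero]

/-- The tensor `N(x_1)^κ_1 ⋯ N(x_n)^κ_n · (C_{m_1} ⊗ ⋯ ⊗ C_{m_n})`, a tensor being given by its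
coefficients at the `C_{i_1} ⊗ ⋯ ⊗ C_{i_n}` and `x_k` lowering the index of the `k`-th factor. -/
noncomputable def powTensor {n : ℕ} (κ m i : Fin n → ℕ) : Jet :=
  ∏ l, powCoeff (κ l) (m l) (i l)

/-- The span of the tensors `N(x_1)^κ_1 ⋯ N(x_n)^κ_n · (C_{m_1} ⊗ ⋯ ⊗ C_{m_n})`. -/
noncomputable def powSpan (n : ℕ) : Submodule ℂ ((Fin n → ℕ) → Jet) :=
  Submodule.span ℂ {f | ∃ κ m : Fin n → ℕ, f = powTensor κ m}

theorem powTensor_mem {n : ℕ} (κ m : Fin n → ℕ) : powTensor κ m ∈ powSpan n :=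
  Submodule.subset_span ⟨κ, m, rfl⟩

theorem prod_update {n : ℕ} (g : Fin n → ℕ → Jet) (i : Fin n → ℕ) (k : Fin n) (a : ℕ) :
    ∏ l, g l (Function.update i k a l) = g k a * ∏ l ∈ Finset.univ.erase k, g l (i l) := by
  rw [← Finset.mul_prod_erase _ _ (Finset.mem_univ k), Function.update_self]
  congr 1
  exact Finset.prod_congr rfl fun l hl => by rw [Function.update_of_ne (Finset.ne_of_mem_erase hl)]

theorem sh_powTensor_succ {n : ℕ} (κ m : Fin n → ℕ) (k : Fin n) (j : ℕ) (h : m k = j + 1) :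
    sh k (powTensor κ m) = powTensor κ (Function.update m k j) := by
  funext i
  rw [sh_apply, powTensor, powTensor, prod_update (fun l a => powCoeff (κ l) (m l) a),
    prod_update (fun l a => powCoeff (κ l) a (i l)), h, powCoeff_succ_succ]

theorem sh_powTensor_zero {n : ℕ} (κ m : Fin n → ℕ) (k : Fin n) (h : m k = 0) :
    sh k (powTensor κ m) = 0 := by
  funext i
  rw [sh_apply, powTensor, prod_update (fun l a => powCoeff (κ l) (m l) a), h,
    powCoeff_of_lt (Nat.succ_pos _), zero_mul, Pi.zero_apply]

theorem sh_mem {n : ℕ} (k : Fin n) (b : (Fin n → ℕ) → Jet) (hb : b ∈ powSpan n) :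
    sh k b ∈ powSpan n := by
  induction hb using Submodule.span_induction with
  | mem f hf =>
    obtain ⟨κ, m, rfl⟩ := hf
    rcases h : m k with _ | j
    · rw [sh_powTensor_zero κ m k h]; exact Submodule.zero_mem _
    · rw [sh_powTensor_succ κ m k j h]; exact powTensor_mem _ _
  | zero => simp
  | add f g _ _ hf hg => rw [map_add]; exact Submodule.add_mem _ hf hg
  | smul c f _ hf => rw [map_smul]; exact Submodule.smul_mem _ _ hf

/-- Multiplication by `x_k - x_l` is onto, since
`C_a ⊗ C_b = (x_1 - x_2) (C_{a+1} ⊗ C_b + C_{a+2} ⊗ C_{b-1} + ⋯)`. -/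
theorem exists_sh_sub_eq {n : ℕ} (k l : Fin n) (hkl : k ≠ l) (b : (Fin n → ℕ) → Jet)
    (hb : b ∈ powSpan n) : ∃ b' ∈ powSpan n, sh k b' - sh l b' = b := by
  induction hb using Submodule.span_induction with
  | mem f hf =>
    obtain ⟨κ, m, rfl⟩ := hf
    induction hj : m l generalizing m with
    | zero =>
      refine ⟨powTensor κ (Function.update m k (m k + 1)), powTensor_mem _ _, ?_⟩
      rw [sh_powTensor_succ _ _ k (m k) (by simp),
        sh_powTensor_zero _ _ l (by rw [Function.update_of_ne hkl.symm, hj])]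
      simp
    | succ j ih =>
      obtain ⟨b', hb', h⟩ := ih (Function.update (Function.update m k (m k + 1)) l j) (by simp)
      refine ⟨powTensor κ (Function.update m k (m k + 1)) + b',
        Submodule.add_mem _ (powTensor_mem _ _) hb', ?_⟩
      rw [map_add, map_add, add_sub_add_comm, h, sh_powTensor_succ _ _ k (m k) (by simp),
        sh_powTensor_succ _ _ l j (by rw [Function.update_of_ne hkl.symm, hj])]
      simp
  | zero => exact ⟨0, Submodule.zero_mem _, by simp⟩
  | add f g _ _ hf hg =>
    obtain ⟨f', hf', rfl⟩ := hf
    obtain ⟨g', hg', rfl⟩ := hg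
    exact ⟨f' + g', Submodule.add_mem _ hf' hg', by simp only [map_add]; abel⟩
  | smul c f _ hf =>
    obtain ⟨f', hf', rfl⟩ := hf
    exact ⟨c • f', Submodule.smul_mem _ _ hf', by simp only [map_smul, smul_sub]⟩

/-- `N(x_k)` preserves `powSpan n`; the series is cut off beyond the support of the tensor. -/
theorem sum_X_smul_sh_mem {n : ℕ} (k : Fin n) (b : (Fin n → ℕ) → Jet) (hb : b ∈ powSpan n) :
    ∀ᶠ L in atTop, ∑ s ∈ Finset.range L, (X (Sum.inl s) : Jet) • (sh k ^ s) b ∈ powSpan n := by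
  induction hb using Submodule.span_induction with
  | mem f hf =>
    obtain ⟨κ, m, rfl⟩ := hf
    filter_upwards [eventually_gt_atTop (m k)] with L hL
    convert powTensor_mem (Function.update κ k (κ k + 1)) m using 1
    funext i
    simp only [Finset.sum_apply, Pi.smul_apply, sh_pow_apply, smul_eq_mul]
    rw [powTensor, prod_update (fun l a => powCoeff a (m l) (i l)), ← sum_X_mul_powCoeff hL,
      Finset.sum_mul]
    refine Finset.sum_congr rfl fun s _ => ?_
    rw [powTensor, prod_update (fun l a => powCoeff (κ l) (m l) a), mul_assoc]
  | zero => simp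
  | add f g _ _ hf hg =>
    filter_upwards [hf, hg] with L h1 h2
    simp only [map_add, smul_add, Finset.sum_add_distrib]
    exact Submodule.add_mem _ h1 h2
  | smul c f _ hf =>
    filter_upwards [hf] with L h1
    simp only [map_smul, smul_comm _ c, ← Finset.smul_sum]
    exact Submodule.smul_mem _ _ h1

/-- The subalgebra generated by the coefficients of all `C(z) N(z)^k`. -/
noncomputable def jetAlg : Subalgebra ℂ Jet :=
  Algebra.adjoin ℂ {P | ∃ k m : ℕ, P = PowerSeries.coeff m (Cser * Nser ^ k)}

/-- Multiplying out the tensor factors takes `powSpan n` into `jetAlg`. -/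
theorem sum_prod_X_mul_mem {n : ℕ} (b : (Fin n → ℕ) → Jet) (hb : b ∈ powSpan n) :
    ∀ᶠ L in atTop, ∑ i ∈ Fintype.piFinset fun _ : Fin n => Finset.range L,
      (∏ l, X (Sum.inr (i l))) * b i ∈ jetAlg := by
  induction hb using Submodule.span_induction with
  | mem f hf =>
    obtain ⟨κ, m, rfl⟩ := hf
    filter_upwards [eventually_all.2 fun l => eventually_gt_atTop (m l)] with L hL
    simp only [powTensor, ← Finset.prod_mul_distrib]
    rw [← Finset.prod_univ_sum (fun _ : Fin n => Finset.range L)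
      (fun l s => X (Sum.inr s) * powCoeff (κ l) (m l) s)]
    refine Subalgebra.prod_mem _ fun l _ => ?_
    rw [sum_X_mul_powCoeff_inr (hL l)]
    exact Algebra.subset_adjoin ⟨_, _, rfl⟩
  | zero => simp
  | add f g _ _ hf hg =>
    filter_upwards [hf, hg] with L h1 h2
    simp only [Pi.add_apply, mul_add, Finset.sum_add_distrib]
    exact Subalgebra.add_mem _ h1 h2
  | smul c f _ hf =>
    filter_upwards [hf] with L h1
    simp only [Pi.smul_apply, mul_smul_comm, ← Finset.smul_sum]
    exact Subalgebra.smul_mem _ h1 c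

end GL11

namespace GL11

open MvPolynomial Filter

/-! ### The Taylor formula -/

section Taylor

variable {σ : Type}

open Classical in
/-- The evaluation at zero of the variables in the range of `v`. -/
noncomputable def setZero (v : ℕ → σ) : MvPolynomial σ ℂ →ₐ[ℂ] MvPolynomial σ ℂ :=
  aeval fun x => if x ∈ Set.range v then 0 else X x

theorem setZero_X_of_notMem {v : ℕ → σ} {x : σ} (h : x ∉ Set.range v) :
    setZero v (X x) = X x := by
  rw [setZero, aeval_X, if_neg h]

theorem setZero_X_self (v : ℕ → σ) (a : ℕ) : setZero v (X (v a)) = 0 := by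
  rw [setZero, aeval_X, if_pos ⟨a, rfl⟩]

theorem setZero_monomial_of_eq_zero {v : ℕ → σ} {d : σ →₀ ℕ} (h : ∀ a, d (v a) = 0) (c : ℂ) :
    setZero v (monomial d c) = monomial d c := by
  rw [setZero, aeval_monomial, monomial_eq, algebraMap_eq]
  congr 1
  refine Finset.prod_congr rfl fun x hx => ?_
  have hx' : x ∉ Set.range v := by
    rintro ⟨a, rfl⟩
    exact Finsupp.mem_support_iff.1 hx (h a)
  simp only [if_neg hx']

theorem setZero_monomial_of_ne_zero {v : ℕ → σ} {d : σ →₀ ℕ} {a : ℕ} (h : d (v a) ≠ 0) (c : ℂ) :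
    setZero v (monomial d c) = 0 := by
  rw [setZero, aeval_monomial, Finsupp.prod, Finset.prod_eq_zero (Finsupp.mem_support_iff.2 h),
    mul_zero]
  rw [if_pos ⟨a, rfl⟩, zero_pow h]

theorem pderiv_setZero {v : ℕ → σ} {x : σ} (h : x ∉ Set.range v) (P : MvPolynomial σ ℂ) :
    pderiv x (setZero v P) = setZero v (pderiv x P) := by
  classical
  induction P using MvPolynomial.induction_on with
  | C c => simp [setZero]
  | add P Q hP hQ => simp only [map_add, hP, hQ]
  | mul_X P y hP =>
    have hy : pderiv x (setZero v (X y)) = setZero v (pderiv x (X y)) := by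
      by_cases hy : y ∈ Set.range v
      · obtain ⟨a, rfl⟩ := hy
        have hne : v a ≠ x := fun e => h ⟨a, e⟩
        rw [setZero_X_self, map_zero, pderiv_X_of_ne hne, map_zero]
      · rw [setZero_X_of_notMem hy, pderiv_X]
        by_cases e : y = x
        · subst e; simp
        · simp [Ne.symm e]
    rw [map_mul, pderiv_mul, pderiv_mul, map_add, map_mul, map_mul, hP, hy]

theorem pderiv_comm (x y : σ) (P : MvPolynomial σ ℂ) :
    pderiv x (pderiv y P) = pderiv y (pderiv x P) := by
  classical
  have h : ⁅(pderiv x : Derivation ℂ (MvPolynomial σ ℂ) (MvPolynomial σ ℂ)),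
      (pderiv y : Derivation ℂ (MvPolynomial σ ℂ) (MvPolynomial σ ℂ))⁆ = 0 := by
    refine MvPolynomial.derivation_ext fun z => ?_
    rw [Derivation.commutator_apply, pderiv_X, pderiv_X, Derivation.zero_apply]
    simp only [Pi.single_apply, apply_ite (pderiv x), apply_ite (pderiv y), map_zero, pderiv_one]
    simp
  have h' := congrArg (fun D => D P) h
  simp only [Derivation.commutator_apply, Derivation.zero_apply] at h'
  exact sub_eq_zero.1 h'

/-- The operators `∑ v_{a_1} ⋯ v_{a_n} (∂_{a_1} ⋯ ∂_{a_n} P)(v = 0)`, with all `a_i < L`, which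
are `n!` times the terms of the Taylor formula in the variables `v_a`. -/
noncomputable def taylorTerm (v : ℕ → σ) (L : ℕ) : ℕ → MvPolynomial σ ℂ →ₗ[ℂ] MvPolynomial σ ℂ
  | 0 => (setZero v).toLinearMap
  | n + 1 => ∑ a ∈ Finset.range L, LinearMap.mulLeft ℂ (X (v a)) ∘ₗ taylorTerm v L n ∘ₗ
      (pderiv (v a)).toLinearMap

theorem taylorTerm_succ (v : ℕ → σ) (L n : ℕ) (P : MvPolynomial σ ℂ) :
    taylorTerm v L (n + 1) P =
      ∑ a ∈ Finset.range L, X (v a) * taylorTerm v L n (pderiv (v a) P) := by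
  simp [taylorTerm]

theorem taylorTerm_monomial {v : ℕ → σ} (hv : v.Injective) {L : ℕ} (n : ℕ) (d : σ →₀ ℕ)
    (hd : ∀ a, L ≤ a → d (v a) = 0) (c : ℂ) :
    taylorTerm v L n (monomial d c) =
      if ∑ a ∈ Finset.range L, d (v a) = n then (n.factorial : ℂ) • monomial d c else 0 := by
  induction n generalizing d c with
  | zero =>
    rw [taylorTerm, AlgHom.toLinearMap_apply]
    split_ifs with h
    · rw [setZero_monomial_of_eq_zero]
      · simp
      · intro a
        by_cases ha : a < L
        · exact Finset.sum_eq_zero_iff.1 h a (Finset.mem_range.2 ha)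
        · exact hd a (not_lt.1 ha)
    · obtain ⟨a, _, ha⟩ := Finset.exists_ne_zero_of_sum_ne_zero h
      exact setZero_monomial_of_ne_zero ha c
  | succ n ih =>
    have key : ∀ a ∈ Finset.range L, X (v a) * taylorTerm v L n (pderiv (v a) (monomial d c)) =
        (if ∑ a ∈ Finset.range L, d (v a) = n + 1 then (n.factorial : ℂ) • monomial d c else 0) *
          (d (v a) : MvPolynomial σ ℂ) := by
      intro a ha
      by_cases h0 : d (v a) = 0
      · simp [pderiv_monomial, h0]
      · have hdeg : ∑ b ∈ Finset.range L, (d - Finsupp.single (v a) 1 : σ →₀ ℕ) (v b) + 1 =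
            ∑ b ∈ Finset.range L, d (v b) := by
          rw [← Finset.add_sum_erase _ _ ha, ← Finset.add_sum_erase _ (fun b => d (v b)) ha,
            Finset.sum_congr rfl fun b hb => show (d - Finsupp.single (v a) 1 : σ →₀ ℕ) (v b) = d (v b) by
              simp [hv.ne (Finset.ne_of_mem_erase hb).symm]]
          simp
          omega
        have hX : X (v a) * pderiv (v a) (monomial d c) = d (v a) • monomial d c :=
          X_mul_pderiv_monomial
        rw [pderiv_monomial] at hX ⊢
        rw [ih _ (fun b hb => by simp [hd b hb])]
        simp only [← hdeg, Nat.add_right_cancel_iff]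
        split_ifs
        · rw [mul_smul_comm, hX, nsmul_eq_mul, smul_mul_assoc, mul_comm]
        · simp
    rw [taylorTerm_succ, Finset.sum_congr rfl key, ← Finset.mul_sum]
    split_ifs with h
    · rw [← Nat.cast_sum, h, mul_comm, ← nsmul_eq_mul, Nat.factorial_succ, Nat.cast_mul,
        ← Nat.cast_smul_eq_nsmul ℂ, smul_smul]
    · simp

/-- The Taylor formula in the variables `v_a`, if only those with `a < L` occur in `P`. -/
theorem sum_taylorTerm {v : ℕ → σ} (hv : v.Injective) {L : ℕ} (P : MvPolynomial σ ℂ)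
    (hP : ∀ d ∈ P.support, ∀ a, L ≤ a → d (v a) = 0) :
    P = ∑ n ∈ Finset.range (P.totalDegree + 1),
      (n.factorial : ℂ)⁻¹ • taylorTerm v L n P := by
  have hK : ∀ d ∈ P.support, ∑ a ∈ Finset.range L, d (v a) < P.totalDegree + 1 := fun d hd => by
    refine Nat.lt_succ_of_le (le_trans ?_ (le_totalDegree hd))
    change ∑ a ∈ Finset.range L, d ((⟨v, hv⟩ : ℕ ↪ σ) a) ≤ _
    rw [← Finset.sum_map (Finset.range L) ⟨v, hv⟩ d]
    exact Finset.sum_le_sum_of_ne_zero fun x _ hx => Finsupp.mem_support_iff.2 hx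
  have h : ∀ n, taylorTerm v L n P = ∑ d ∈ P.support,
      if ∑ a ∈ Finset.range L, d (v a) = n then (n.factorial : ℂ) • monomial d (coeff d P)
        else 0 := fun n => by
    conv_lhs => rw [P.as_sum]
    rw [map_sum]
    exact Finset.sum_congr rfl fun d hd => taylorTerm_monomial hv n d (hP d hd) _
  simp only [h, Finset.smul_sum]
  rw [Finset.sum_comm]
  conv_lhs => rw [P.as_sum]
  refine Finset.sum_congr rfl fun d hd => ?_
  rw [Finset.sum_eq_single (∑ a ∈ Finset.range L, d (v a))]
  · rw [if_pos rfl, smul_smul, inv_mul_cancel₀ (by exact_mod_cast Nat.factorial_ne_zero _), one_smul]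
  · intro n _ hn
    rw [if_neg hn.symm, smul_zero]
  · intro hn
    exact absurd (Finset.mem_range.2 (hK d hd)) hn

end Taylor

/-! ### Polarization -/

theorem inl_notMem (s : ℕ) : (Sum.inl s : ℕ ⊕ ℕ) ∉ Set.range (Sum.inr : ℕ → ℕ ⊕ ℕ) := by simp

theorem inr_notMem (s : ℕ) : (Sum.inr s : ℕ ⊕ ℕ) ∉ Set.range (Sum.inl : ℕ → ℕ ⊕ ℕ) := by simp

/-- The coefficient at `C_{i_1} ⊗ ⋯ ⊗ C_{i_n}` of the polarization of the part of degree `n` in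
the `C_r` of a polynomial. -/
noncomputable def polAt : (n : ℕ) → (Fin n → ℕ) → Jet →ₗ[ℂ] Jet
  | 0, _ => (setZero Sum.inr).toLinearMap
  | n + 1, i => polAt n (Fin.tail i) ∘ₗ (pderiv (Sum.inr (i 0))).toLinearMap

/-- The polarization of the part of degree `n` in the `C_r` of a polynomial. -/
noncomputable def pol (n : ℕ) : Jet →ₗ[ℂ] ((Fin n → ℕ) → Jet) := LinearMap.pi (polAt n)

theorem pol_zero_apply (P : Jet) (i : Fin 0 → ℕ) : pol 0 P i = setZero Sum.inr P := rfl

theorem pol_succ_apply {n : ℕ} (P : Jet) (i : Fin (n + 1) → ℕ) :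
    pol (n + 1) P i = pol n (pderiv (Sum.inr (i 0)) P) (Fin.tail i) := rfl

theorem sum_piFinset_succ {M : Type*} [AddCommMonoid M] (n : ℕ) (s : Finset ℕ)
    (f : (Fin (n + 1) → ℕ) → M) :
    ∑ i ∈ Fintype.piFinset (fun _ => s), f i =
      ∑ a ∈ s, ∑ j ∈ Fintype.piFinset (fun _ => s), f (Fin.cons a j) := by
  rw [← Finset.sum_product']
  refine Finset.sum_bij' (fun i _ => (i 0, Fin.tail i)) (fun q _ => Fin.cons q.1 q.2)
    ?_ ?_ ?_ ?_ ?_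
  · intro i hi
    rw [Fintype.mem_piFinset] at hi
    simp [Fin.tail, hi]
  · rintro ⟨a, j⟩ h
    simp only [Finset.mem_product, Fintype.mem_piFinset] at h ⊢
    exact Fin.cases h.1 h.2
  · intro i _
    simp
  · rintro ⟨a, j⟩ _
    simp
  · intro i _
    simp

theorem taylorTerm_inr_eq (L n : ℕ) (P : Jet) :
    taylorTerm Sum.inr L n P = ∑ i ∈ Fintype.piFinset fun _ : Fin n => Finset.range L,
      (∏ l, X (Sum.inr (i l))) * pol n P i := by
  induction n generalizing P with
  | zero => simp [taylorTerm, pol_zero_apply]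
  | succ n ih =>
    rw [taylorTerm_succ, sum_piFinset_succ]
    refine Finset.sum_congr rfl fun a _ => ?_
    rw [ih, Finset.mul_sum]
    refine Finset.sum_congr rfl fun j _ => ?_
    rw [pol_succ_apply, Fin.prod_univ_succ, mul_assoc]
    simp

theorem pol_X_mul {n : ℕ} (s : ℕ) (P : Jet) (i : Fin n → ℕ) :
    pol n (X (Sum.inl s) * P) i = X (Sum.inl s) * pol n P i := by
  induction n generalizing P with
  | zero => rw [pol_zero_apply, map_mul, setZero_X_of_notMem (inl_notMem s), pol_zero_apply]
  | succ n ih =>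
    rw [pol_succ_apply, pderiv_mul, pderiv_X_of_ne (by simp), zero_mul, zero_add, ih,
      pol_succ_apply]

theorem pol_mul_X {n : ℕ} (b : ℕ) (Q : Jet) (i : Fin (n + 1) → ℕ) :
    pol (n + 1) (Q * X (Sum.inr b)) i =
      ∑ k, if i k = b then pol n Q (i ∘ k.succAbove) else 0 := by
  induction n generalizing Q with
  | zero =>
    rw [pol_succ_apply, pol_zero_apply, pderiv_mul, map_add, map_mul, setZero_X_self, mul_zero,
      zero_add, Fin.sum_univ_succ, Fin.sum_univ_zero, add_zero]
    by_cases h : i 0 = b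
    · rw [if_pos h, h, pderiv_X_self, mul_one, pol_zero_apply]
    · rw [if_neg h, pderiv_X_of_ne (by simpa using Ne.symm h), mul_zero, map_zero]
  | succ n ih =>
    rw [pol_succ_apply, pderiv_mul, map_add, Pi.add_apply, ih, Fin.sum_univ_succ (n := n + 1), add_comm]
    have htail : ∀ k : Fin (n + 1), Fin.tail i ∘ k.succAbove = Fin.tail (i ∘ k.succ.succAbove) :=
      fun k => funext fun j => by simp [Fin.tail]
    refine congrArg₂ (· + ·) ?_ (Finset.sum_congr rfl fun k _ => by
      rw [pol_succ_apply, htail, Function.comp_apply, Fin.succ_succAbove_zero]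
      rfl)
    by_cases h : i 0 = b
    · rw [if_pos h, h, pderiv_X_self, mul_one]
      rfl
    · rw [pderiv_X_of_ne (by simpa using Ne.symm h), mul_zero, map_zero, Pi.zero_apply, if_neg h]

theorem pol_eq_zero {n L : ℕ} (P : Jet) (hP : ∀ a, L ≤ a → pderiv (Sum.inr a) P = 0)
    (i : Fin n → ℕ) (l : Fin n) (hl : L ≤ i l) : pol n P i = 0 := by
  induction n generalizing P with
  | zero => exact l.elim0
  | succ n ih =>
    rw [pol_succ_apply]
    refine l.cases (fun h => ?_) (fun l h => ?_) hl
    · rw [hP _ h, map_zero, Pi.zero_apply]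
    · exact ih _ (fun a ha => by rw [pderiv_comm, hP a ha, map_zero]) _ l h

theorem setZero_inl_inr (P : Jet) :
    setZero Sum.inr (setZero Sum.inl P) = MvPolynomial.C (constantCoeff P) := by
  have h : (setZero Sum.inr).comp (setZero Sum.inl) =
      (Algebra.ofId ℂ Jet).comp (aeval fun _ : ℕ ⊕ ℕ => (0 : ℂ)) := by
    refine MvPolynomial.algHom_ext fun x => ?_
    rcases x with s | s
    · simp [setZero_X_self]
    · simp [setZero_X_of_notMem (inr_notMem s), setZero_X_self]
  have h' := AlgHom.congr_fun h P
  rw [AlgHom.comp_apply, AlgHom.comp_apply, aeval_zero'] at h'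
  exact h'

theorem pol_setZero {n : ℕ} (P : Jet) (i : Fin n → ℕ) :
    ∃ c : ℂ, pol n (setZero Sum.inl P) i = MvPolynomial.C c := by
  induction n generalizing P with
  | zero => exact ⟨_, setZero_inl_inr P⟩
  | succ n ih =>
    rw [pol_succ_apply, pderiv_setZero (inr_notMem _)]
    exact ih _ _

theorem pol_setZero_mem {n L : ℕ} (P : Jet) (hP : ∀ a, L ≤ a → pderiv (Sum.inr a) P = 0) :
    pol n (setZero Sum.inl P) ∈ powSpan n := by
  choose c hc using pol_setZero (n := n) P
  have h : pol n (setZero Sum.inl P) =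
      ∑ m ∈ Fintype.piFinset fun _ : Fin n => Finset.range L, c m • powTensor 0 m := by
    funext i
    have hpow : ∀ m, powTensor 0 m i = if m = i then 1 else 0 := fun m => by
      unfold powTensor
      simp only [Pi.zero_apply, powCoeff_zero]
      split_ifs with h
      · simp [h]
      · obtain ⟨l, hl⟩ := Function.ne_iff.1 h
        exact Finset.prod_eq_zero (Finset.mem_univ l) (if_neg (Ne.symm hl))
    simp only [Finset.sum_apply, Pi.smul_apply, hpow, smul_ite, smul_zero, Finset.sum_ite_eq']
    split_ifs with hi
    · rw [hc, smul_eq_C_mul, mul_one]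
    · simp only [Fintype.mem_piFinset, Finset.mem_range, not_forall, not_lt] at hi
      obtain ⟨l, hl⟩ := hi
      exact pol_eq_zero _ (fun a ha => by rw [pderiv_setZero (inr_notMem _), hP a ha, map_zero])
        i l hl
  rw [h]
  exact Submodule.sum_mem _ fun m _ => Submodule.smul_mem _ _ (powTensor_mem _ _)

/-! ### The first-order condition -/

/-- The first-order condition `∂P/∂N_s = ∑_b C_b Q_{b+s}` for all `s`: the polynomial `P` stays a
polynomial, to first order in `ε`, under `N(z) ↦ N(z) + ε w(z) / C(z)`. -/
def FirstOrder (P : Jet) : Prop :=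
  ∃ (Q : ℕ → Jet) (L : ℕ), (∀ a, L ≤ a → Q a = 0) ∧ ∀ s,
    pderiv (Sum.inl s) P = ∑ b ∈ Finset.range L, Q (b + s) * X (Sum.inr b)

theorem FirstOrder.pderiv {P : Jet} (h : FirstOrder P) (t : ℕ) :
    FirstOrder (pderiv (Sum.inl t) P) := by
  obtain ⟨Q, L, hQ, h⟩ := h
  refine ⟨fun a => MvPolynomial.pderiv (Sum.inl t) (Q a), L, fun a ha => by simp [hQ a ha],
    fun s => ?_⟩
  rw [pderiv_comm, h s, map_sum]
  refine Finset.sum_congr rfl fun b _ => ?_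
  rw [pderiv_mul, pderiv_X_of_ne (by simp), mul_zero, add_zero]

theorem taylorTerm_mul_X_inr (L k b : ℕ) (Q : Jet) :
    taylorTerm Sum.inl L k (Q * X (Sum.inr b)) = taylorTerm Sum.inl L k Q * X (Sum.inr b) := by
  induction k generalizing Q with
  | zero =>
    simp only [taylorTerm, AlgHom.toLinearMap_apply, map_mul, setZero_X_of_notMem (inr_notMem b)]
  | succ k ih =>
    rw [taylorTerm_succ, taylorTerm_succ, Finset.sum_mul]
    refine Finset.sum_congr rfl fun a _ => ?_
    rw [pderiv_mul, pderiv_X_of_ne (by simp), mul_zero, add_zero, ih, mul_assoc]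

/-- Under the first-order condition the polarizations of the derivatives `∂P/∂N_s` are power sums
in the operators `x_k`. -/
theorem FirstOrder.exists_powerSum {P : Jet} (h : FirstOrder P) (n L k : ℕ) :
    ∃ w : Fin n → (Fin n → ℕ) → Jet, ∀ s,
      pol n (taylorTerm Sum.inl L k (MvPolynomial.pderiv (Sum.inl s) P)) =
        ∑ l, (sh l ^ s) (w l) := by
  obtain ⟨Q, M, hQ, h⟩ := h
  simp only [h, map_sum, taylorTerm_mul_X_inr]
  rcases n with _ | n
  · refine ⟨0, fun s => funext fun i => ?_⟩
    simp [pol_zero_apply, setZero_X_self]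
  · refine ⟨fun l i => pol n (taylorTerm Sum.inl L k (Q (i l))) (i ∘ l.succAbove),
      fun s => funext fun i => ?_⟩
    simp only [Finset.sum_apply, pol_mul_X, sh_pow_apply, Function.update_self]
    rw [Finset.sum_comm]
    refine Finset.sum_congr rfl fun l _ => ?_
    rw [Finset.sum_ite_eq]
    have hu : Function.update i l (i l + s) ∘ l.succAbove = i ∘ l.succAbove := by
      funext j
      simp
    rw [hu]
    split_ifs with hl
    · rfl
    · rw [hQ _ (by rw [Finset.mem_range] at hl; omega)]
      simp

/-- By induction on the degree `k` in the `N_r`: the power sums `pol (∂P/∂N_s)` lie in `powSpan n`,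
hence so do suitable summands `w' l`, and `∑ N_s x_l^s w'_l = N(x_l) w'_l`. -/
theorem FirstOrder.pol_taylorTerm_mem {P : Jet} (h : FirstOrder P) {L : ℕ}
    (hN : ∀ a, L ≤ a → MvPolynomial.pderiv (Sum.inl a) P = 0)
    (hC : ∀ a, L ≤ a → MvPolynomial.pderiv (Sum.inr a) P = 0) (n k : ℕ) :
    pol n (taylorTerm Sum.inl L k P) ∈ powSpan n := by
  induction k generalizing P with
  | zero => exact pol_setZero_mem P hC
  | succ k ih =>
    obtain ⟨w, hw⟩ := h.exists_powerSum n L k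
    obtain ⟨w', hw', hsum⟩ := GL11.exists_powerSum sh sh_commute (powSpan n) sh_mem
      exists_sh_sub_eq Finset.univ
      (fun s => pol n (taylorTerm Sum.inl L k (MvPolynomial.pderiv (Sum.inl s) P)))
      (fun s => ih (h.pderiv s) (fun a ha => by rw [pderiv_comm, hN a ha, map_zero])
        (fun a ha => by rw [pderiv_comm, hC a ha, map_zero])) w hw
    obtain ⟨M, hM, hLM⟩ := ((eventually_all.2 fun l => sum_X_smul_sh_mem l (w' l) (hw' l)).and
      (eventually_ge_atTop L)).exists
    have key : pol n (taylorTerm Sum.inl L (k + 1) P) =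
        ∑ l, ∑ s ∈ Finset.range M, (X (Sum.inl s) : Jet) • (sh l ^ s) (w' l) := by
      rw [Finset.sum_comm, taylorTerm_succ, map_sum,
        ← Finset.sum_subset (Finset.range_mono hLM)]
      · refine Finset.sum_congr rfl fun s _ => ?_
        rw [← Finset.smul_sum, ← hsum s]
        exact funext fun i => pol_X_mul s _ i
      · intro s _ hs
        rw [← Finset.smul_sum, ← hsum s, hN s (by simpa using hs), map_zero, map_zero, smul_zero]
    rw [key]
    exact Submodule.sum_mem _ fun l _ => hM l

/-- A polynomial with the first-order condition is a polynomial in the coefficients of the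
`C(z) N(z)^k`: apply the Taylor formula in the `N_r`, and then in the `C_r`. -/
theorem FirstOrder.mem_jetAlg {P : Jet} (h : FirstOrder P) : P ∈ jetAlg := by
  obtain ⟨L, hL⟩ : ∃ L, ∀ a, L ≤ a → Sum.inl a ∉ P.vars ∧ Sum.inr a ∉ P.vars := by
    refine ⟨P.vars.sup (Sum.elim id id) + 1, fun a ha => ⟨fun hm => ?_, fun hm => ?_⟩⟩
    · have := Finset.le_sup (f := Sum.elim id id) hm
      simp only [Sum.elim_inl, id] at this
      omega
    · have := Finset.le_sup (f := Sum.elim id id) hm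
      simp only [Sum.elim_inr, id] at this
      omega
  have hvar : ∀ x, x ∉ P.vars → ∀ d ∈ P.support, d x = 0 := fun x hx d hd => by
    by_contra h0
    exact hx ((mem_vars_iff_mem_support x).2 ⟨d, hd, Finsupp.mem_support_iff.2 h0⟩)
  have hK := sum_taylorTerm Sum.inl_injective P fun d hd a ha => hvar _ (hL a ha).1 d hd
  have hmem : ∀ n, pol n P ∈ powSpan n := fun n => by
    rw [hK, map_sum]
    refine Submodule.sum_mem _ fun k _ => ?_
    rw [map_smul]
    exact Submodule.smul_mem _ _ (h.pol_taylorTerm_mem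
      (fun a ha => pderiv_eq_zero_of_notMem_vars (hL a ha).1)
      (fun a ha => pderiv_eq_zero_of_notMem_vars (hL a ha).2) n k)
  obtain ⟨M, hM, hLM⟩ := (((eventually_all_finset (Finset.range (P.totalDegree + 1))).2 fun n _ =>
    sum_prod_X_mul_mem (pol n P) (hmem n)).and (eventually_ge_atTop L)).exists
  rw [sum_taylorTerm Sum.inr_injective (L := M) P
    fun d hd a ha => hvar _ (hL a (hLM.trans ha)).2 d hd]
  refine Subalgebra.sum_mem _ fun n hn => Subalgebra.smul_mem _ ?_ _
  rw [taylorTerm_inr_eq]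
  exact hM n hn

end GL11

namespace GL11

/-! ### Symmetric superalgebras -/

theorem koszul_zero_left (a : ZMod 2) : koszul 0 a = 1 := by simp [koszul]

theorem koszul_zero_right (a : ZMod 2) : koszul a 0 = 1 := by simp [koszul]

theorem koszul_one_one : koszul 1 1 = -1 := by simp [koszul]

theorem eq_zero_or_eq_one (a : ZMod 2) : a = 0 ∨ a = 1 := by
  revert a; decide

namespace SSym

variable {X : Type} {p : X → ZMod 2}

theorem even_mul_comm {x : X} (hx : p x = 0) (u : SSym p) : ι p x * u = u * ι p x := by
  obtain ⟨u, rfl⟩ := mk_surjective u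
  induction u using FreeAlgebra.induction with
  | grade0 r => rw [AlgHom.commutes, Algebra.commutes]
  | grade1 y =>
    change ι p x * ι p y = ι p y * ι p x
    rw [ι_mul_ι, hx, koszul_zero_left, one_smul]
  | mul a b ha hb => rw [map_mul, ← mul_assoc, ha, mul_assoc, hb, mul_assoc]
  | add a b ha hb => rw [map_add, mul_add, ha, hb, add_mul]

theorem induction_mul {motive : SSym p → Prop} (one : motive 1)
    (ι_mul : ∀ x u, motive u → motive (ι p x * u))
    (add : ∀ u v, motive u → motive v → motive (u + v))
    (smul : ∀ (c : ℂ) u, motive u → motive (c • u)) (u : SSym p) : motive u := by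
  have key : ∀ u v : SSym p, motive v → motive (u * v) := fun u => by
    obtain ⟨u, rfl⟩ := mk_surjective u
    induction u using FreeAlgebra.induction with
    | grade0 r =>
      intro v hv
      rw [AlgHom.commutes, ← Algebra.smul_def]
      exact smul r v hv
    | grade1 y => exact ι_mul y
    | mul a b ha hb =>
      intro v hv
      rw [map_mul, mul_assoc]
      exact ha _ (hb _ hv)
    | add a b ha hb =>
      intro v hv
      rw [map_add, add_mul]
      exact add _ _ (ha _ hv) (hb _ hv)
  simpa using key u 1 one

/-! ### Partial derivatives -/

open Classical in
theorem ite_mul_ι (x y z : X) :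
    (if y = x then (1 : SSym p) else 0) * ι p z =
      koszul (p y + p x) (p z) • (ι p z * if y = x then 1 else 0) := by
  split_ifs with h
  · rw [h, CharTwo.add_self_eq_zero, koszul_zero_left, one_smul, one_mul, mul_one]
  · simp

/-- The homomorphism `u ↦ [[(-1)^(q|u|) u, D u], [0, u]]` attached to a superderivation `D` of
parity `q` with homogeneous values `g x` on the basis vectors. In contrast to `derMatrix`, which asks
for values in `V`, this applies to partial derivatives, whose values are constants. -/
noncomputable def leibnizMatrix (q : ZMod 2) (g : X → SSym p)
    (hg : ∀ y z, g y * ι p z = koszul (p y + q) (p z) • (ι p z * g y)) :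
    SSym p →ₐ[ℂ] Matrix (Fin 2) (Fin 2) (SSym p) :=
  lift (fun y => !![koszul q (p y) • ι p y, g y; 0, ι p y]) (fun y z => by
    have hy := hg y z
    have hz := hg z y
    have hyz := ι_mul_ι (p := p) y z
    ext i j
    fin_cases i <;> fin_cases j
    · simp [hyz, smul_smul]
      congr 1
      ring
    · simp [hy, hz]
      rcases eq_zero_or_eq_one (p y) with h | h <;> rcases eq_zero_or_eq_one (p z) with h' | h' <;>
        rcases eq_zero_or_eq_one q with h'' | h'' <;>
        simp [h, h', h'', koszul, show (1 : ZMod 2) + 1 = 0 from rfl] <;>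
        first | done | rw [add_comm]
    · simp
    · simp [hyz])

open Classical in
/-- The homomorphism `u ↦ [[±u, ∂u], [0, u]]` attached to the partial derivative `∂` with respect
to the basis vector `x`, a superderivation of the parity of `x`. -/
noncomputable def pderivMatrix (x : X) : SSym p →ₐ[ℂ] Matrix (Fin 2) (Fin 2) (SSym p) :=
  leibnizMatrix (p x) (fun y => if y = x then 1 else 0) (ite_mul_ι x)

open Classical in
theorem pderivMatrix_ι (x y : X) : pderivMatrix x (ι p y) =
    Matrix.of ![![koszul (p x) (p y) • ι p y, if y = x then 1 else 0], ![0, ι p y]] := by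
  rw [pderivMatrix, leibnizMatrix, lift_ι]

/-- The partial derivative of `S(V)` with respect to the basis vector `x`. -/
noncomputable def pd (x : X) : SSym p →ₗ[ℂ] SSym p where
  toFun u := pderivMatrix x u 0 1
  map_add' u v := by simp
  map_smul' c u := by simp

theorem pderivMatrix_one_one (x : X) (u : SSym p) : pderivMatrix x u 1 1 = u := by
  have h : pderivMatrix x u 1 0 = 0 ∧ pderivMatrix x u 1 1 = u := by
    induction u using induction_mul with
    | one => simp
    | ι_mul y u hu =>
      rw [map_mul, Matrix.mul_apply, Matrix.mul_apply, Fin.sum_univ_two, Fin.sum_univ_two, hu.1,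
        hu.2, pderivMatrix_ι]
      simp
    | add u v hu hv => simp [hu, hv]
    | smul c u hu => simp [hu]
  exact h.2

@[simp] theorem pd_one (x : X) : pd x (1 : SSym p) = 0 := by
  simp [pd]

open Classical in
theorem pd_ι_mul (x y : X) (u : SSym p) :
    pd x (ι p y * u) = (if y = x then u else 0) + koszul (p x) (p y) • (ι p y * pd x u) := by
  have h : pd x (ι p y * u) = (pderivMatrix x (ι p y) * pderivMatrix x u) 0 1 := by
    simp [pd]
  rw [h, Matrix.mul_apply, Fin.sum_univ_two, pderivMatrix_one_one, add_comm, pderivMatrix_ι]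
  simp [pd]

theorem pd_self_mul (x : X) (u : SSym p) :
    pd x (ι p x * u) = u + koszul (p x) (p x) • (ι p x * pd x u) := by
  rw [pd_ι_mul, if_pos rfl]

theorem pd_mul_of_ne {x y : X} (h : y ≠ x) (u : SSym p) :
    pd x (ι p y * u) = koszul (p x) (p y) • (ι p y * pd x u) := by
  rw [pd_ι_mul, if_neg h, zero_add]

theorem pd_comm {x : X} (hx : p x = 0) (y : X) (u : SSym p) : pd x (pd y u) = pd y (pd x u) := by
  classical
  induction u using induction_mul with
  | one => simp
  | ι_mul z u hu =>
    simp only [pd_ι_mul, map_add, map_smul, hx, koszul_zero_left, one_smul, hu, smul_add,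
      apply_ite (pd x), apply_ite (pd y), map_zero]
    by_cases hzx : z = x
    · subst hzx
      simp only [hx, koszul_zero_right, one_smul, if_true]
      abel
    · simp only [if_neg hzx, smul_zero]
      abel
  | add u v hu hv => simp only [map_add, hu, hv]
  | smul c u hu => simp only [map_smul, hu]

theorem superDer_ι_mul (q : ZMod 2) (f : X → SSym p) (hf : ∀ x, f x ∈ linearPart p (p x + q))
    (x : X) (u : SSym p) :
    superDer q f hf (ι p x * u) = f x * u + koszul q (p x) • (ι p x * superDer q f hf u) := by
  rw [superDer_mul, superDer_ι, signAut, lift_ι, smul_mul_assoc]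

theorem superDer_one (q : ZMod 2) (f : X → SSym p) (hf : ∀ x, f x ∈ linearPart p (p x + q)) :
    superDer q f hf 1 = 0 := by
  simpa using superDer_algebraMap q f hf 1

/-! ### The Taylor formula in the odd variables -/

open Classical in
/-- The evaluation at zero of the odd basis vectors. -/
noncomputable def evenPart (p : X → ZMod 2) : SSym p →ₐ[ℂ] SSym p :=
  lift (fun x => if p x = 0 then ι p x else 0) (fun x y => by
    by_cases hx : p x = 0 <;> by_cases hy : p y = 0 <;> simp [hx, hy]
    rw [ι_mul_ι, hx, hy])

theorem evenPart_ι_of_even {x : X} (hx : p x = 0) : evenPart p (ι p x) = ι p x := by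
  simp [evenPart, hx]

theorem evenPart_ι_of_odd {x : X} (hx : p x = 1) : evenPart p (ι p x) = 0 := by
  simp [evenPart, hx]

/-- The product of the basis vectors in a list. -/
noncomputable def word (p : X → ZMod 2) (l : List X) : SSym p := (l.map (ι p)).prod

theorem word_cons (x : X) (l : List X) : word p (x :: l) = ι p x * word p l := by
  simp [word]

open Classical in
/-- The number of odd basis vectors in a list. -/
noncomputable def oddCount (p : X → ZMod 2) (l : List X) : ℕ := l.countP fun x => p x = 1

theorem oddCount_cons_of_even {x : X} (hx : p x = 0) (l : List X) :
    oddCount p (x :: l) = oddCount p l := by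
  simp [oddCount, hx]

theorem oddCount_cons_of_odd {x : X} (hx : p x = 1) (l : List X) :
    oddCount p (x :: l) = oddCount p l + 1 := by
  simp [oddCount, hx]

/-- The span of the words with `k` odd letters, all of them in `Y`. -/
noncomputable def wordSpan (p : X → ZMod 2) (Y : Finset X) (k : ℕ) : Submodule ℂ (SSym p) :=
  Submodule.span ℂ {u | ∃ l, (∀ x ∈ l, p x = 1 → x ∈ Y) ∧ oddCount p l = k ∧ u = word p l}

theorem even_mul_mem {Y : Finset X} {k : ℕ} {x : X} (hx : p x = 0) {u : SSym p}
    (hu : u ∈ wordSpan p Y k) : ι p x * u ∈ wordSpan p Y k := by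
  induction hu using Submodule.span_induction with
  | mem u hu =>
    obtain ⟨l, hl, hk, rfl⟩ := hu
    refine Submodule.subset_span ⟨x :: l, ?_, ?_, (word_cons x l).symm⟩
    · simpa [hx] using hl
    · rw [oddCount_cons_of_even hx, hk]
  | zero => simp
  | add u v _ _ hu hv => rw [mul_add]; exact Submodule.add_mem _ hu hv
  | smul c u _ hu => rw [mul_smul_comm]; exact Submodule.smul_mem _ _ hu

theorem odd_mul_mem {Y : Finset X} {k : ℕ} {x : X} (hx : p x = 1) (hxY : x ∈ Y) {u : SSym p}
    (hu : u ∈ wordSpan p Y k) : ι p x * u ∈ wordSpan p Y (k + 1) := by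
  induction hu using Submodule.span_induction with
  | mem u hu =>
    obtain ⟨l, hl, hk, rfl⟩ := hu
    refine Submodule.subset_span ⟨x :: l, ?_, ?_, (word_cons x l).symm⟩
    · intro y hy hy1
      rcases List.mem_cons.1 hy with rfl | hy
      · exact hxY
      · exact hl y hy hy1
    · rw [oddCount_cons_of_odd hx, hk]
  | zero => simp
  | add u v _ _ hu hv => rw [mul_add]; exact Submodule.add_mem _ hu hv
  | smul c u _ hu => rw [mul_smul_comm]; exact Submodule.smul_mem _ _ hu

theorem pd_word {Y : Finset X} {y : X} (hy : p y = 1) (l : List X)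
    (hl : ∀ x ∈ l, p x = 1 → x ∈ Y) :
    (oddCount p l = 0 → pd y (word p l) = 0) ∧
      ∀ k, oddCount p l = k + 1 → pd y (word p l) ∈ wordSpan p Y k := by
  classical
  induction l with
  | nil => simp [word, oddCount]
  | cons x l ih =>
    obtain ⟨ih0, ih1⟩ := ih fun z hz => hl z (List.mem_cons_of_mem x hz)
    rw [word_cons]
    rcases eq_zero_or_eq_one (p x) with hx | hx
    · have hne : x ≠ y := fun h => by rw [h, hy] at hx; exact one_ne_zero hx
      rw [oddCount_cons_of_even hx, pd_mul_of_ne hne]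
      refine ⟨fun h => by rw [ih0 h, mul_zero, smul_zero], fun k hk => ?_⟩
      exact Submodule.smul_mem _ _ (even_mul_mem hx (ih1 k hk))
    · rw [oddCount_cons_of_odd hx, pd_ι_mul]
      refine ⟨fun h => absurd h (Nat.succ_ne_zero _), fun k hk => Submodule.add_mem _ ?_
        (Submodule.smul_mem _ _ ?_)⟩
      · split_ifs
        · exact Submodule.subset_span
            ⟨l, fun z hz => hl z (List.mem_cons_of_mem x hz), Nat.succ_injective hk, rfl⟩
        · exact Submodule.zero_mem _
      · rcases k with _ | k
        · rw [ih0 (Nat.succ_injective hk), mul_zero]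
          exact Submodule.zero_mem _
        · exact odd_mul_mem hx (hl x List.mem_cons_self hx) (ih1 k (Nat.succ_injective hk))

/-- Euler's formula in the odd variables. -/
theorem sum_mul_pd_word {Y : Finset X} (hY : ∀ y ∈ Y, p y = 1) (l : List X)
    (hl : ∀ x ∈ l, p x = 1 → x ∈ Y) :
    ∑ y ∈ Y, ι p y * pd y (word p l) = (oddCount p l : ℂ) • word p l := by
  classical
  induction l with
  | nil => simp [word, oddCount]
  | cons x l ih =>
    have ih' := ih fun z hz => hl z (List.mem_cons_of_mem x hz)
    have hcomm : ∀ y ∈ Y, ι p y * (koszul (p y) (p x) • (ι p x * pd y (word p l))) =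
        ι p x * (ι p y * pd y (word p l)) := fun y _ => by
      rw [← mul_assoc (ι p x), ι_mul_ι x y, mul_smul_comm, ← mul_assoc, smul_mul_assoc]
      congr 1
      unfold koszul
      simp only [and_comm]
    rw [word_cons]
    simp only [pd_ι_mul, mul_add, Finset.sum_add_distrib]
    rw [Finset.sum_congr rfl hcomm, ← Finset.mul_sum, ih']
    rcases eq_zero_or_eq_one (p x) with hx | hx
    · rw [oddCount_cons_of_even hx, Finset.sum_eq_zero, zero_add, mul_smul_comm]
      intro y hy
      rw [if_neg, mul_zero]
      rintro rfl
      rw [hY _ hy] at hx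
      exact one_ne_zero hx
    · rw [oddCount_cons_of_odd hx, Finset.sum_eq_single x, if_pos rfl, Nat.cast_succ, add_smul,
        one_smul, mul_smul_comm, add_comm]
      · intro y _ hyx
        rw [if_neg hyx.symm, mul_zero]
      · intro h
        exact absurd (hl x List.mem_cons_self hx) h

theorem evenPart_word (l : List X) :
    evenPart p (word p l) = if oddCount p l = 0 then word p l else 0 := by
  induction l with
  | nil => simp [word, oddCount]
  | cons x l ih =>
    rw [word_cons, map_mul, ih]
    rcases eq_zero_or_eq_one (p x) with hx | hx
    · rw [evenPart_ι_of_even hx, oddCount_cons_of_even hx, mul_ite, mul_zero]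
    · rw [evenPart_ι_of_odd hx, oddCount_cons_of_odd hx, zero_mul, if_neg (Nat.succ_ne_zero _)]

/-- `n!` times the term of degree `n` of the Taylor formula in the odd variables in `Y`. -/
noncomputable def oddTaylor (Y : Finset X) : ℕ → SSym p →ₗ[ℂ] SSym p
  | 0 => (evenPart p).toLinearMap
  | n + 1 => ∑ y ∈ Y, LinearMap.mulLeft ℂ (ι p y) ∘ₗ oddTaylor Y n ∘ₗ pd y

theorem oddTaylor_succ (Y : Finset X) (n : ℕ) (u : SSym p) :
    oddTaylor Y (n + 1) u = ∑ y ∈ Y, ι p y * oddTaylor Y n (pd y u) := by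
  simp [oddTaylor]

theorem oddTaylor_word {Y : Finset X} (hY : ∀ y ∈ Y, p y = 1) (n : ℕ) (l : List X)
    (hl : ∀ x ∈ l, p x = 1 → x ∈ Y) :
    oddTaylor Y n (word p l) = if oddCount p l = n then (n.factorial : ℂ) • word p l else 0 := by
  induction n generalizing l with
  | zero =>
    rw [oddTaylor, AlgHom.toLinearMap_apply, evenPart_word]
    simp
  | succ n ih =>
    rw [oddTaylor_succ]
    rcases hk : oddCount p l with _ | k
    · rw [if_neg (Nat.succ_ne_zero n).symm]
      exact Finset.sum_eq_zero fun y hy => by rw [(pd_word (hY y hy) l hl).1 hk, map_zero, mul_zero]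
    · have hspan : ∀ u ∈ wordSpan p Y k,
          oddTaylor Y n u = if k = n then (n.factorial : ℂ) • u else 0 := fun u hu => by
        induction hu using Submodule.span_induction with
        | mem u hu =>
          obtain ⟨l', hl', hk', rfl⟩ := hu
          rw [ih l' hl', hk']
        | zero => simp
        | add u v _ _ hu hv =>
          rw [map_add, hu, hv]
          split_ifs <;> simp
        | smul c u _ hu =>
          rw [map_smul, hu]
          split_ifs
          · rw [smul_comm]
          · simp
      rw [Finset.sum_congr rfl fun y hy => by
        rw [hspan _ ((pd_word (hY y hy) l hl).2 k hk)]]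
      simp only [Nat.add_right_cancel_iff]
      split_ifs with h
      · subst h
        simp only [mul_smul_comm]
        rw [← Finset.smul_sum, sum_mul_pd_word hY l hl, hk, smul_smul, Nat.factorial_succ]
        push_cast
        rw [mul_comm]
      · simp

theorem exists_sum_word (u : SSym p) :
    ∃ c : List X →₀ ℂ, u = ∑ l ∈ c.support, c l • word p l := by
  have h : u ∈ Submodule.span ℂ (Set.range (word p)) := by
    induction u using induction_mul with
    | one => exact Submodule.subset_span ⟨[], by simp [word]⟩
    | ι_mul x u hu =>
      induction hu using Submodule.span_induction with
      | mem u hu =>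
        obtain ⟨l, rfl⟩ := hu
        exact Submodule.subset_span ⟨x :: l, word_cons x l⟩
      | zero => simp
      | add u v _ _ hu hv => rw [mul_add]; exact Submodule.add_mem _ hu hv
      | smul c u _ hu => rw [mul_smul_comm]; exact Submodule.smul_mem _ _ hu
    | add u v hu hv => exact Submodule.add_mem _ hu hv
    | smul c u hu => exact Submodule.smul_mem _ _ hu
  obtain ⟨c, hc⟩ := Finsupp.mem_span_range_iff_exists_finsupp.1 h
  exact ⟨c, hc.symm⟩

/-- The composite of the partial derivatives with respect to the members of a list. -/
noncomputable def pdList (l : List X) : SSym p →ₗ[ℂ] SSym p :=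
  match l with
  | [] => LinearMap.id
  | y :: l => pdList l ∘ₗ pd y

theorem pdList_nil (u : SSym p) : pdList [] u = u := rfl

theorem pdList_cons (y : X) (l : List X) (u : SSym p) :
    pdList (y :: l) u = pdList l (pd y u) := rfl

/-- An element all of whose iterated odd partial derivatives vanish at zero is zero. -/
theorem eq_zero_of_evenPart_pdList (u : SSym p)
    (hu : ∀ l : List X, (∀ y ∈ l, p y = 1) → evenPart p (pdList l u) = 0) : u = 0 := by
  classical
  obtain ⟨c, hc⟩ := exists_sum_word u
  let Y : Finset X := (c.support.biUnion List.toFinset).filter fun x => p x = 1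
  have hY : ∀ y ∈ Y, p y = 1 := fun y hy => (Finset.mem_filter.1 hy).2
  have hl : ∀ l ∈ c.support, ∀ x ∈ l, p x = 1 → x ∈ Y := fun l hl x hx hx1 =>
    Finset.mem_filter.2 ⟨Finset.mem_biUnion.2 ⟨l, hl, List.mem_toFinset.2 hx⟩, hx1⟩
  have h0 : ∀ n, ∀ v : SSym p,
      (∀ l : List X, (∀ y ∈ l, p y = 1) → evenPart p (pdList l v) = 0) →
      oddTaylor Y n v = 0 := fun n => by
    induction n with
    | zero => exact fun v hv => hv [] (by simp)
    | succ n ih =>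
      intro v hv
      rw [oddTaylor_succ]
      refine Finset.sum_eq_zero fun y hy => ?_
      rw [ih (pd y v) fun l hl => hv (y :: l) fun z hz => ?_, mul_zero]
      rcases List.mem_cons.1 hz with rfl | hz
      · exact hY _ hy
      · exact hl z hz
  have hn : ∀ n : ℕ, (0 : SSym p) = ∑ l ∈ c.support,
      if oddCount p l = n then (n.factorial : ℂ) • c l • word p l else 0 := fun n => by
    refine (h0 n u hu).symm.trans ?_
    conv_lhs => rw [hc]
    rw [map_sum]
    refine Finset.sum_congr rfl fun l h => ?_
    rw [map_smul, oddTaylor_word hY n l (hl l h), smul_ite, smul_zero, smul_comm]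
  have hsum : u = ∑ n ∈ c.support.image (oddCount p), (n.factorial : ℂ)⁻¹ •
      ∑ l ∈ c.support, if oddCount p l = n then (n.factorial : ℂ) • c l • word p l else 0 := by
    conv_lhs => rw [hc]
    simp only [Finset.smul_sum]
    rw [Finset.sum_comm]
    refine Finset.sum_congr rfl fun l h => ?_
    rw [Finset.sum_eq_single (oddCount p l), if_pos rfl, smul_smul, inv_mul_cancel₀, one_smul]
    · exact_mod_cast Nat.factorial_ne_zero _
    · intro n _ hn
      rw [if_neg hn.symm, smul_zero]
    · exact fun hn => absurd (Finset.mem_image_of_mem _ h) hn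
  rw [hsum]
  simp only [← hn, smul_zero, Finset.sum_const_zero]

end SSym

end GL11

namespace GL11

open Filter MvPolynomial

/-! ### Generators of the loop algebra -/

theorem par_zero_zero : par (0, 0) = 0 := by simp [par]

theorem par_one_one : par (1, 1) = 0 := by
  simp [par, show (1 : ZMod 2) + 1 = 0 from rfl]

theorem par_zero_one : par (0, 1) = 1 := by simp [par]

theorem par_one_zero : par (1, 0) = 1 := by simp [par]

theorem index_cases (c : Fin 2 × Fin 2) :
    c = (0, 0) ∨ c = (0, 1) ∨ c = (1, 0) ∨ c = (1, 1) := by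
  revert c; decide

theorem par_eq_one_iff (c : Fin 2 × Fin 2) : par c = 1 ↔ c = (0, 1) ∨ c = (1, 0) := by
  rcases index_cases c with rfl | rfl | rfl | rfl <;>
    simp [par_zero_zero, par_zero_one, par_one_zero, par_one_one]

/-- The generator `E_c[-r-1]`. -/
noncomputable def gen (c : Fin 2 × Fin 2) (r : ℕ) : SLoop := SSym.ι parLoop (c, r)

/-- The central elements `C_r = (E_11 + E_22)[-r-1]`. -/
noncomputable def genC (r : ℕ) : SLoop := gen (0, 0) r + gen (1, 1) r

theorem gen_mul_comm {c : Fin 2 × Fin 2} (hc : par c = 0) (r : ℕ) (u : SLoop) :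
    gen c r * u = u * gen c r :=
  SSym.even_mul_comm (p := parLoop) (x := (c, r)) hc u

theorem genC_mul_comm (r : ℕ) (u : SLoop) : genC r * u = u * genC r := by
  rw [genC, add_mul, mul_add, gen_mul_comm par_zero_zero, gen_mul_comm par_one_one]

/-! ### Restriction to the even part -/

/-- The values of the `E_ij[-r-1]` under the restriction to the even part. -/
noncomputable def restrGen (x : (Fin 2 × Fin 2) × ℕ) : Jet :=
  if x.1 = (0, 0) then X (Sum.inl x.2) else
    if x.1 = (1, 1) then X (Sum.inr x.2) - X (Sum.inl x.2) else 0

theorem restrGen_of_odd {x : (Fin 2 × Fin 2) × ℕ} (hx : parLoop x = 1) : restrGen x = 0 := by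
  rcases (par_eq_one_iff x.1).1 hx with h | h <;> simp [restrGen, h]

/-- The homomorphism from `S(t⁻¹ g[t⁻¹])` to polynomials which sets `E_12` and `E_21` to zero and
writes `E_11[-r-1] = N_r`, `E_22[-r-1] = C_r - N_r`. -/
noncomputable def restr : SLoop →ₐ[ℂ] Jet :=
  SSym.lift restrGen (fun x y => by
    by_cases h : parLoop x = 1 ∧ parLoop y = 1
    · rw [restrGen_of_odd h.1, zero_mul, mul_zero, smul_zero]
    · rw [koszul, if_neg h, one_smul, mul_comm])

theorem restr_gen_zero_zero (r : ℕ) : restr (gen (0, 0) r) = X (Sum.inl r) := by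
  simp [restr, gen, restrGen]

theorem restr_gen_one_one (r : ℕ) : restr (gen (1, 1) r) = X (Sum.inr r) - X (Sum.inl r) := by
  simp [restr, gen, restrGen]

theorem restr_gen_of_odd {c : Fin 2 × Fin 2} (hc : par c = 1) (r : ℕ) : restr (gen c r) = 0 := by
  rw [restr, gen, SSym.lift_ι]
  exact restrGen_of_odd (x := (c, r)) hc

theorem restr_genC (r : ℕ) : restr (genC r) = X (Sum.inr r) := by
  rw [genC, map_add, restr_gen_zero_zero, restr_gen_one_one, add_sub_cancel]

theorem gen_mem_center {c : Fin 2 × Fin 2} (hc : par c = 0) (r : ℕ) :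
    gen c r ∈ Subalgebra.center ℂ SLoop :=
  Subalgebra.mem_center_iff.2 fun u => (gen_mul_comm hc r u).symm

/-- The polynomials in the even generators, as elements of the symmetric superalgebra. -/
noncomputable def evenIncl : Jet →ₐ[ℂ] SLoop :=
  (Subalgebra.center ℂ SLoop).val.comp (aeval (Sum.elim
    (fun r => ⟨gen (0, 0) r, gen_mem_center par_zero_zero r⟩)
    (fun r => ⟨gen (0, 0) r, gen_mem_center par_zero_zero r⟩ +
      ⟨gen (1, 1) r, gen_mem_center par_one_one r⟩)))

theorem evenIncl_restr (u : SLoop) : evenIncl (restr u) = SSym.evenPart parLoop u := by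
  have h : evenIncl.comp restr = SSym.evenPart parLoop := by
    refine SSym.hom_ext fun x => ?_
    obtain ⟨c, r⟩ := x
    change evenIncl (restr (gen c r)) = _
    rcases index_cases c with rfl | rfl | rfl | rfl
    · rw [restr_gen_zero_zero, SSym.evenPart_ι_of_even (p := parLoop) (x := ((0, 0), r)) par_zero_zero]
      simp [evenIncl, gen]
    · rw [restr_gen_of_odd par_zero_one,
        SSym.evenPart_ι_of_odd (p := parLoop) (x := ((0, 1), r)) par_zero_one, map_zero]
    · rw [restr_gen_of_odd par_one_zero,
        SSym.evenPart_ι_of_odd (p := parLoop) (x := ((1, 0), r)) par_one_zero, map_zero]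
    · rw [restr_gen_one_one, SSym.evenPart_ι_of_even (p := parLoop) (x := ((1, 1), r)) par_one_one]
      simp [evenIncl, gen]
  exact AlgHom.congr_fun h u

/-! ### The odd currents as differential operators -/

/-- The partial derivative with respect to `E_c[-r-1]`. -/
noncomputable def dGen (c : Fin 2 × Fin 2) (r : ℕ) : SLoop →ₗ[ℂ] SLoop :=
  SSym.pd (p := parLoop) (c, r)

/-- The partial derivative with respect to `N_r`, when `E_11[-r-1] = N_r` and
`E_22[-r-1] = C_r - N_r`. -/
noncomputable def dN (r : ℕ) : SLoop →ₗ[ℂ] SLoop := dGen (0, 0) r - dGen (1, 1) r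

theorem dN_apply (r : ℕ) (u : SLoop) : dN r u = dGen (0, 0) r u - dGen (1, 1) r u := rfl

theorem dGen_self_mul (c : Fin 2 × Fin 2) (r : ℕ) (u : SLoop) :
    dGen c r (gen c r * u) = u + koszul (par c) (par c) • (gen c r * dGen c r u) :=
  SSym.pd_self_mul (p := parLoop) (c, r) u

theorem dGen_mul_of_ne {c c' : Fin 2 × Fin 2} {r r' : ℕ} (h : c' ≠ c ∨ r' ≠ r) (u : SLoop) :
    dGen c r (gen c' r' * u) = koszul (par c) (par c') • (gen c' r' * dGen c r u) :=
  SSym.pd_mul_of_ne (p := parLoop) (x := (c, r)) (y := (c', r'))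
    (fun e => by rw [Prod.mk.injEq] at e; tauto) u

/-- The derivatives of `E_11` and `E_22` with respect to `N`. -/
noncomputable def valN (c : Fin 2 × Fin 2) : ℂ :=
  if c = (0, 0) then 1 else if c = (1, 1) then -1 else 0

theorem dN_gen_mul (r : ℕ) (c : Fin 2 × Fin 2) (r' : ℕ) (u : SLoop) :
    dN r (gen c r' * u) =
      (if r' = r then valN c • u else 0) + gen c r' * dN r u := by
  have h0 : dGen (0, 0) r (gen c r' * u) =
      (if r' = r then (if c = (0, 0) then u else 0) else 0) + gen c r' * dGen (0, 0) r u := by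
    rw [dGen, gen, SSym.pd_ι_mul]
    change _ + koszul (par (0, 0)) _ • _ = _
    rw [par_zero_zero, koszul_zero_left, one_smul, ← ite_and]
    congr 1
    simp only [Prod.mk.injEq, and_comm]
  have h1 : dGen (1, 1) r (gen c r' * u) =
      (if r' = r then (if c = (1, 1) then u else 0) else 0) + gen c r' * dGen (1, 1) r u := by
    rw [dGen, gen, SSym.pd_ι_mul]
    change _ + koszul (par (1, 1)) _ • _ = _
    rw [par_one_one, koszul_zero_left, one_smul, ← ite_and]
    congr 1
    simp only [Prod.mk.injEq, and_comm]
  rw [dN_apply, h0, h1, dN_apply, mul_sub]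
  by_cases hr : r' = r
  · rcases index_cases c with rfl | rfl | rfl | rfl <;> simp [hr, valN] <;> abel
  · simp [hr]

theorem dN_dGen (r : ℕ) (c : Fin 2 × Fin 2) (r' : ℕ) (u : SLoop) :
    dN r (dGen c r' u) = dGen c r' (dN r u) := by
  rw [dN_apply, dN_apply, map_sub]
  congr 1
  · exact SSym.pd_comm (p := parLoop) (x := ((0, 0), r)) par_zero_zero _ u
  · exact SSym.pd_comm (p := parLoop) (x := ((1, 1), r)) par_one_one _ u

theorem restr_dN (r : ℕ) (u : SLoop) : restr (dN r u) = pderiv (Sum.inl r) (restr u) := by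
  classical
  induction u using SSym.induction_mul with
  | one => simp [dN, dGen]
  | ι_mul x u hu =>
    obtain ⟨c, r'⟩ := x
    change restr (dN r (gen c r' * u)) = pderiv (Sum.inl r) (restr (gen c r' * u))
    have hX : pderiv (Sum.inl r) (restr (gen c r')) =
        if r' = r then MvPolynomial.C (valN c) else 0 := by
      rcases index_cases c with rfl | rfl | rfl | rfl
      · rw [restr_gen_zero_zero, pderiv_X]
        by_cases h : r' = r <;> simp [h, valN]
      · rw [restr_gen_of_odd par_zero_one]; simp [valN]
      · rw [restr_gen_of_odd par_one_zero]; simp [valN]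
      · rw [restr_gen_one_one, map_sub, pderiv_X, pderiv_X]
        by_cases h : r' = r <;> simp [h, valN]
    rw [dN_gen_mul, map_add, map_mul, map_mul, pderiv_mul, hX, hu]
    congr 1
    split_ifs
    · rw [map_smul, smul_eq_C_mul]
    · rw [map_zero, zero_mul]
  | add u v hu hv => simp only [map_add, hu, hv]
  | smul c u hu => rw [map_smul, map_smul, map_smul, Derivation.map_smul, hu]

theorem dGen_genC_mul {c : Fin 2 × Fin 2} (hc : par c = 1) (r b : ℕ) (u : SLoop) :
    dGen c r (genC b * u) = genC b * dGen c r u := by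
  have h0 : (0, 0) ≠ c := fun h => by rw [← h, par_zero_zero] at hc; exact zero_ne_one hc
  have h1 : (1, 1) ≠ c := fun h => by rw [← h, par_one_one] at hc; exact zero_ne_one hc
  rw [genC, add_mul, map_add, dGen_mul_of_ne (Or.inl h0), dGen_mul_of_ne (Or.inl h1),
    par_zero_zero, par_one_one, koszul_zero_right, one_smul, one_smul, add_mul]

/-- The action of `E_a[s]` on `S(t⁻¹ g[t⁻¹])`. -/
noncomputable def act (a : Fin 2 × Fin 2) (s : ℕ) : SLoop →ₗ[ℂ] SLoop :=
  SSym.superDer (p := parLoop) (par a) (adLoop (a, s)) (adLoop_mem (a, s))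

theorem mem_invLoop_iff (u : SLoop) : u ∈ invLoop ↔ ∀ a s, act a s u = 0 :=
  ⟨fun h a s => h (a, s), fun h a => h a.1 a.2⟩

theorem act_gen_mul (a : Fin 2 × Fin 2) (s : ℕ) (c : Fin 2 × Fin 2) (r : ℕ) (u : SLoop) :
    act a s (gen c r * u) =
      adLoop (a, s) (c, r) * u + koszul (par a) (par c) • (gen c r * act a s u) :=
  SSym.superDer_ι_mul (p := parLoop) _ _ _ _ _

theorem adLoop_of_lt {a c : Fin 2 × Fin 2} {s r : ℕ} (h : r < s) : adLoop (a, s) (c, r) = 0 := by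
  simp [adLoop, h]

theorem adLoop_eq_sum (a c : Fin 2 × Fin 2) (s b : ℕ) :
    adLoop (a, s) (c, b + s) = ∑ d : Fin 2 × Fin 2, bracket a c d.1 d.2 • gen d b := by
  simp [adLoop, gen]

/-- The sign with which `[E_a, E_11] = ± E_a` for odd `a`. -/
noncomputable def oddSign (a : Fin 2 × Fin 2) : ℂ := if a = (0, 1) then -1 else 1

theorem adLoop_odd {a : Fin 2 × Fin 2} (ha : par a = 1) (c : Fin 2 × Fin 2) (s b : ℕ) :
    adLoop (a, s) (c, b + s) =
      oddSign a • gen a b * algebraMap ℂ SLoop (valN c) + if c = a.swap then genC b else 0 := by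
  simp only [adLoop_eq_sum, genC, Fintype.sum_prod_type, Fin.sum_univ_two]
  rcases (par_eq_one_iff a).1 ha with rfl | rfl <;>
    rcases index_cases c with rfl | rfl | rfl | rfl <;>
    simp [bracket, koszul, par_zero_zero, par_zero_one, par_one_zero, par_one_one, oddSign, valN]

/-- For odd `E_a` with opposite `E_a'`, the action of `E_a[s]` is the vector field
`∑ ± E_a[-b-1] ∂/∂N_(b+s) + C_b ∂/∂E_a'[-b-s-1]`. -/
theorem act_eq_sum {a : Fin 2 × Fin 2} (ha : par a = 1) (u : SLoop) :
    ∀ᶠ L in atTop, ∀ s, act a s u = ∑ b ∈ Finset.range L,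
      (oddSign a • gen a b * dN (b + s) u + genC b * dGen a.swap (b + s) u) := by
  have ha' : par a.swap = 1 := by
    rw [par_eq_one_iff] at ha ⊢
    rcases ha with rfl | rfl <;> simp
  induction u using SSym.induction_mul with
  | one =>
    refine Eventually.of_forall fun L s => ?_
    simp [act, SSym.superDer_one, dN, dGen]
  | ι_mul x u hu =>
    obtain ⟨c, r⟩ := x
    change ∀ᶠ L in atTop, ∀ s, act a s (gen c r * u) = ∑ b ∈ Finset.range L,
      (oddSign a • gen a b * dN (b + s) (gen c r * u) +
        genC b * dGen a.swap (b + s) (gen c r * u))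
    filter_upwards [hu, eventually_gt_atTop r] with L hL hr s
    have hsum : adLoop (a, s) (c, r) * u =
        ∑ b ∈ Finset.range L, if r = b + s then adLoop (a, s) (c, b + s) * u else 0 := by
      by_cases hs : s ≤ r
      · rw [Finset.sum_eq_single (r - s)]
        · rw [if_pos (by omega), Nat.sub_add_cancel hs]
        · intro b _ hb
          rw [if_neg (by omega)]
        · intro h
          exact absurd (Finset.mem_range.2 (by omega)) h
      · rw [adLoop_of_lt (not_le.1 hs), zero_mul]
        exact (Finset.sum_eq_zero fun b _ => if_neg (by omega)).symm
    rw [act_gen_mul, hsum, hL s, Finset.mul_sum, Finset.smul_sum, ← Finset.sum_add_distrib]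
    refine Finset.sum_congr rfl fun b _ => ?_
    have hswap : gen a b * gen c r = koszul (par a) (par c) • (gen c r * gen a b) :=
      SSym.ι_mul_ι (p := parLoop) (a, b) (c, r)
    have hd : dGen a.swap (b + s) (gen c r * u) = (if r = b + s then
        (if c = a.swap then u else 0) else 0) +
          koszul (par a) (par c) • (gen c r * dGen a.swap (b + s) u) := by
      by_cases h : c = a.swap ∧ r = b + s
      · obtain ⟨rfl, rfl⟩ := h
        rw [dGen_self_mul, if_pos rfl, if_pos rfl, ha, ha']
      · rw [dGen_mul_of_ne (by tauto), ← ite_and, if_neg (by tauto), zero_add, ha, ha']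
    have h1 : oddSign a • gen a b * (gen c r * dN (b + s) u) =
        koszul (par a) (par c) • (gen c r * (oddSign a • gen a b * dN (b + s) u)) := by
      rw [← mul_assoc, smul_mul_assoc, hswap, smul_mul_assoc, smul_mul_assoc, smul_mul_assoc,
        mul_smul_comm, mul_assoc, smul_comm]
    have h2 : ∀ v, genC b * (gen c r * v) = gen c r * (genC b * v) := fun v => by
      rw [← mul_assoc, genC_mul_comm, mul_assoc]
    rw [dN_gen_mul, hd, adLoop_odd ha, mul_add (genC b), mul_add, mul_add, mul_smul_comm _ (genC b), h1,
      h2, smul_add]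
    split_ifs with h h'
    · simp only [add_mul, mul_assoc, ← Algebra.smul_def]
      abel
    · simp only [add_zero, mul_assoc, ← Algebra.smul_def, mul_zero, zero_add]
      abel
    · simp
  | add u v hu hv =>
    filter_upwards [hu, hv] with L h1 h2 s
    rw [map_add, h1, h2, ← Finset.sum_add_distrib]
    refine Finset.sum_congr rfl fun b _ => ?_
    simp only [map_add, mul_add]
    abel
  | smul c u hu =>
    filter_upwards [hu] with L h1 s
    rw [map_smul, h1, Finset.smul_sum]
    simp only [map_smul, mul_smul_comm, smul_add]

theorem dGen_eventually_zero (u : SLoop) : ∀ᶠ L in atTop, ∀ c, ∀ r, L ≤ r → dGen c r u = 0 := by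
  induction u using SSym.induction_mul with
  | one => exact Eventually.of_forall fun L c r _ => SSym.pd_one _
  | ι_mul x u hu =>
    filter_upwards [hu, eventually_gt_atTop x.2] with L hL hx c r hr
    have hne : x ≠ (c, r) := fun h => by rw [h] at hx; exact absurd hr (not_le.2 hx)
    rw [dGen, SSym.pd_mul_of_ne hne]
    change _ • (_ * dGen c r u) = 0
    rw [hL c r hr, mul_zero, smul_zero]
  | add u v hu hv =>
    filter_upwards [hu, hv] with L h1 h2 c r hr
    rw [map_add, h1 c r hr, h2 c r hr, add_zero]
  | smul a u hu =>
    filter_upwards [hu] with L h1 c r hr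
    rw [map_smul, h1 c r hr, smul_zero]

/-- The restriction of an invariant to the even part satisfies the first-order condition: look at
the coefficient of `E_12[-1]` in `E_12[s] u = 0`. -/
theorem firstOrder_restr {u : SLoop} (hu : u ∈ invLoop) : FirstOrder (restr u) := by
  obtain ⟨L, hact, hzero, hL⟩ := ((act_eq_sum par_zero_one u).and
    ((dGen_eventually_zero u).and (eventually_gt_atTop 0))).exists
  refine ⟨fun r => restr (dGen (0, 1) 0 (dGen (1, 0) r u)), L, fun r hr => ?_, fun s => ?_⟩
  · simp only [hzero _ r hr, map_zero]
  · have h := congrArg (fun v => restr (dGen (0, 1) 0 v)) ((mem_invLoop_iff u).1 hu (0, 1) s)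
    simp only [hact s, map_sum, map_zero] at h
    have hterm : ∀ b, restr (dGen (0, 1) 0 (oddSign (0, 1) • gen (0, 1) b * dN (b + s) u +
        genC b * dGen (0, 1).swap (b + s) u)) =
        (if b = 0 then -pderiv (Sum.inl s) (restr u) else 0) +
          restr (dGen (0, 1) 0 (dGen (1, 0) (b + s) u)) * X (Sum.inr b) := fun b => by
      rw [map_add, map_add, dGen_genC_mul par_zero_one, map_mul restr, restr_genC,
        mul_comm (X (Sum.inr b)), smul_mul_assoc, map_smul, map_smul, Prod.swap_prod_mk]
      congr 1
      rw [oddSign, if_pos rfl, neg_smul, one_smul]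
      by_cases hb : b = 0
      · subst hb
        rw [dGen_self_mul, map_add, map_smul, map_mul restr, restr_gen_of_odd par_zero_one, zero_mul,
          smul_zero, add_zero, zero_add, restr_dN, if_pos rfl]
      · rw [dGen_mul_of_ne (Or.inr hb), map_smul, map_mul restr, restr_gen_of_odd par_zero_one, zero_mul,
          smul_zero, neg_zero, if_neg hb]
    rw [Finset.sum_congr rfl fun b _ => hterm b, Finset.sum_add_distrib, Finset.sum_ite_eq',
      if_pos (Finset.mem_range.2 hL)] at h
    exact (neg_add_eq_zero.1 h)

/-! ### Injectivity of the restriction on invariants -/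

/-- The triangular system `∑_b C_b q_(b+s) = 0` has only the zero solution. -/
theorem eq_zero_of_sum_X_mul {q : ℕ → Jet} {L : ℕ} (hq : ∀ r, L ≤ r → q r = 0)
    (h : ∀ s, ∑ b ∈ Finset.range L, X (Sum.inr b) * q (b + s) = 0) (r : ℕ) : q r = 0 := by
  induction hk : L - r using Nat.strong_induction_on generalizing r with
  | _ k ih =>
    by_cases hr : L ≤ r
    · exact hq r hr
    · have hlater : ∀ b, b ≠ 0 → q (b + r) = 0 := fun b hb =>
        ih (L - (b + r)) (by omega) (b + r) rfl
      have h' := h r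
      rw [Finset.sum_eq_single 0 (fun b _ hb => by rw [hlater b hb, mul_zero])
        (fun h0 => absurd (Finset.mem_range.2 (by omega)) h0), zero_add] at h'
      exact (mul_eq_zero.1 h').resolve_left (X_ne_zero _)

/-- The restrictions to the even part of the iterated odd derivatives of order less than `k`
vanish. -/
def VanishesToOrder (k : ℕ) (u : SLoop) : Prop :=
  ∀ l : List ((Fin 2 × Fin 2) × ℕ), (∀ y ∈ l, parLoop y = 1) → l.length < k →
    restr (SSym.pdList l u) = 0

theorem VanishesToOrder.pd {k : ℕ} {u : SLoop} (h : VanishesToOrder (k + 1) u)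
    {y : (Fin 2 × Fin 2) × ℕ} (hy : parLoop y = 1) : VanishesToOrder k (SSym.pd y u) :=
  fun l hl hk => h (y :: l) (by simpa [hy] using hl) (by simpa using hk)

theorem VanishesToOrder.odd_mul {k : ℕ} {u : SLoop} (h : VanishesToOrder k u)
    {c : Fin 2 × Fin 2} (hc : par c = 1) (b : ℕ) : VanishesToOrder (k + 1) (gen c b * u) := by
  intro l hl hk
  induction l generalizing k u with
  | nil => rw [SSym.pdList_nil, map_mul, restr_gen_of_odd hc, zero_mul]
  | cons y l ih =>
    have hl' : ∀ z ∈ l, parLoop z = 1 := fun z hz => hl z (List.mem_cons_of_mem y hz)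
    have hy := hl y List.mem_cons_self
    rw [List.length_cons, Nat.succ_lt_succ_iff] at hk
    obtain ⟨k, rfl⟩ : ∃ j, k = j + 1 := ⟨k - 1, by omega⟩
    rw [SSym.pdList_cons, gen, SSym.pd_ι_mul, map_add, map_add, map_smul, map_smul]
    have h1 := ih (h.pd hy) hl' hk
    rw [gen] at h1
    rw [h1, smul_zero, add_zero]
    split_ifs
    · exact h l hl' hk
    · rw [map_zero, map_zero]

theorem pdList_dN (l : List ((Fin 2 × Fin 2) × ℕ)) (r : ℕ) (u : SLoop) :
    SSym.pdList l (dN r u) = dN r (SSym.pdList l u) := by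
  induction l generalizing u with
  | nil => rfl
  | cons y l ih =>
    rw [SSym.pdList_cons, SSym.pdList_cons, ← ih]
    exact congrArg _ (dN_dGen r y.1 y.2 u).symm

theorem VanishesToOrder.dN {k : ℕ} {u : SLoop} (h : VanishesToOrder k u) (r : ℕ) :
    VanishesToOrder k (dN r u) := fun l hl hk => by
  rw [pdList_dN, restr_dN, h l hl hk, map_zero]

theorem pdList_genC_mul (l : List ((Fin 2 × Fin 2) × ℕ)) (hl : ∀ y ∈ l, parLoop y = 1) (b : ℕ)
    (u : SLoop) : SSym.pdList l (genC b * u) = genC b * SSym.pdList l u := by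
  induction l generalizing u with
  | nil => rfl
  | cons y l ih =>
    rw [SSym.pdList_cons, SSym.pdList_cons, ← ih fun z hz => hl z (List.mem_cons_of_mem y hz)]
    exact congrArg _ (dGen_genC_mul (hl y List.mem_cons_self) y.2 b u)

/-- An invariant which vanishes on the even part vanishes there to all orders: by `E_a[s] u = 0` for
odd `E_a`, the derivatives of the next order solve the system of `eq_zero_of_sum_X_mul`. -/
theorem vanishesToOrder_of_mem_invLoop {u : SLoop} (hu : u ∈ invLoop) (h0 : restr u = 0) (k : ℕ) :
    VanishesToOrder k u := by
  induction k with
  | zero => exact fun l _ hl => absurd hl (Nat.not_lt_zero _)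
  | succ k ih =>
    rintro (_ | ⟨⟨c, r⟩, l⟩) hl hk
    · exact h0
    · have hc : par c = 1 := hl _ List.mem_cons_self
      have hl' : ∀ z ∈ l, parLoop z = 1 := fun z hz => hl z (List.mem_cons_of_mem _ hz)
      rw [List.length_cons, Nat.succ_lt_succ_iff] at hk
      have hc' : par c.swap = 1 := by
        rw [par_eq_one_iff] at hc ⊢
        rcases hc with rfl | rfl <;> simp
      obtain ⟨L, hact, hzero⟩ := ((act_eq_sum hc' u).and (dGen_eventually_zero u)).exists
      refine eq_zero_of_sum_X_mul (q := fun r => restr (SSym.pdList l (GL11.dGen c r u))) (L := L)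
        (fun r hr => by rw [hzero c r hr, map_zero, map_zero]) (fun s => ?_) r
      have h := congrArg (fun v => restr (SSym.pdList l v)) ((mem_invLoop_iff u).1 hu c.swap s)
      simp only [hact s, map_sum, map_zero] at h
      rw [← h]
      refine Finset.sum_congr rfl fun b _ => ?_
      rw [map_add, map_add, smul_mul_assoc, map_smul, map_smul,
        (ih.dN (b + s)).odd_mul hc' b l hl' (by omega), smul_zero, zero_add,
        pdList_genC_mul l hl', map_mul restr, restr_genC, Prod.swap_swap]

/-- Invariants are determined by their restrictions to the even part. -/
theorem eq_zero_of_restr_eq_zero {u : SLoop} (hu : u ∈ invLoop) (h0 : restr u = 0) : u = 0 :=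
  SSym.eq_zero_of_evenPart_pdList u fun l hl => by
    rw [← evenIncl_restr, vanishesToOrder_of_mem_invLoop hu h0 (l.length + 1) l hl
      (Nat.lt_succ_self _), map_zero]

end GL11

namespace GL11

/-! ### The map `f ↦ c f(n + q / c)` -/

section Twist

open Polynomial

variable {Z : Type*} [CommRing Z] {c : Z}

/-- The quotient `(X^k - (X-c)^k) / c`. -/
noncomputable def diffQuot (c : Z) : ℕ → Z[X]
  | 0 => 0
  | k + 1 => X * diffQuot c k + (X - C c) ^ k

theorem C_mul_diffQuot (k : ℕ) : C c * diffQuot c k = X ^ k - (X - C c) ^ k := by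
  induction k with
  | zero => simp [diffQuot]
  | succ k ih =>
    rw [diffQuot]
    linear_combination X * ih

/-- The value `c f(n) + q f'(n)` of `c f(n + q / c)` for a square zero element `q`, which is a
polynomial in `q`, `n` and `c` without denominators. -/
noncomputable def twist (c n q : Z) : Z[X] →ₗ[Z] Z :=
  c • leval n + q • (leval n ∘ₗ derivative)

theorem twist_apply (c n q : Z) (f : Z[X]) :
    twist c n q f = c * f.eval n + q * (derivative f).eval n := rfl

theorem twist_X_pow (c n q : Z) (m : ℕ) :
    twist c n q (X ^ m) = n ^ m * c + m • (n ^ (m - 1) * q) := by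
  simp [twist_apply, derivative_X_pow]
  ring

theorem twist_C_sub_X_pow (c n q : Z) (m : ℕ) :
    twist c n q ((C c - X) ^ m) = (c - n) ^ m * c - m • ((c - n) ^ (m - 1) * q) := by
  simp [twist_apply, derivative_pow]
  ring

/-- The sums `∑ (i+1) n^i l^j` over `i + j = k - 2`, with `l = n - c`. -/
noncomputable def traceA (c n : Z) : ℕ → Z
  | 0 => 0
  | k + 1 => n * traceA c n k + (diffQuot c k).eval n

/-- The sums `∑ (j+1) n^i l^j` over `i + j = k - 2`, with `l = n - c`. -/
noncomputable def traceB (c n : Z) : ℕ → Z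
  | 0 => 0
  | k + 1 => (n - c) * traceB c n k + (diffQuot c k).eval n

theorem eval_diffQuot_succ (n : Z) (k : ℕ) :
    (diffQuot c (k + 1)).eval n = n * (diffQuot c k).eval n + (n - c) ^ k := by
  simp [diffQuot]

theorem eval_diffQuot_succ' (n : Z) (k : ℕ) :
    (diffQuot c (k + 1)).eval n = (n - c) * (diffQuot c k).eval n + n ^ k := by
  have h := congrArg (eval n) (C_mul_diffQuot (c := c) k)
  simp only [eval_mul, eval_C, eval_sub, eval_pow, eval_X] at h
  rw [eval_diffQuot_succ]
  linear_combination h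

theorem eval_diffQuot_eq_traceB (n : Z) (k : ℕ) :
    (diffQuot c k).eval n = c * traceB c n k + k * (n - c) ^ (k - 1) := by
  induction k with
  | zero => simp [diffQuot, traceB]
  | succ k ih =>
    have h := congrArg (eval n) (C_mul_diffQuot (c := c) k)
    simp only [eval_mul, eval_C, eval_sub, eval_pow, eval_X] at h
    rw [eval_diffQuot_succ', traceB, Nat.add_sub_cancel]
    rcases k with _ | k
    · simp [diffQuot, traceB]
    · rw [Nat.add_sub_cancel] at ih
      push_cast at ih ⊢
      linear_combination (n - c) * ih - h

theorem eval_derivative_diffQuot (n : Z) (k : ℕ) :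
    (derivative (diffQuot c k)).eval n = traceA c n k + traceB c n k := by
  induction k with
  | zero => simp [diffQuot, traceA, traceB]
  | succ k ih =>
    have h := eval_diffQuot_eq_traceB (c := c) n k
    rw [traceA, traceB, diffQuot]
    simp only [derivative_add, derivative_mul, derivative_X, derivative_pow, derivative_sub,
      derivative_C, eval_add, eval_mul, eval_X, eval_pow, eval_sub, eval_C, ih, one_mul, sub_zero,
      mul_one]
    linear_combination -h

theorem twist_diffQuot (c n q : Z) (k : ℕ) :
    twist c n q (diffQuot c k) =
      n ^ k - (n - c) ^ k + q * (traceA c n k + traceB c n k) := by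
  have h := congrArg (eval n) (C_mul_diffQuot (c := c) k)
  simp only [eval_mul, eval_C, eval_sub, eval_pow, eval_X] at h
  rw [twist_apply, eval_derivative_diffQuot, h]

end Twist

/-! ### Homogeneous polynomials -/

section Homog

open Polynomial

variable {Z : Type*} [CommRing Z] [Algebra ℂ Z] {c : Z}

/-- `f` is a homogeneous polynomial `∑ α_j c^(m-j) X^j` of degree `m` in `X` and `c`, with
complex coefficients and the leading coefficient `a` in `X`. -/
def IsHomog (c : Z) (m : ℕ) (a : ℂ) (f : Z[X]) : Prop :=
  ∃ α : ℕ → ℂ, α m = a ∧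
    f = ∑ j ∈ Finset.range (m + 1), C (algebraMap ℂ Z (α j) * c ^ (m - j)) * X ^ j

theorem isHomog_one : IsHomog c 0 1 1 := ⟨1, rfl, by simp⟩

theorem IsHomog.add {m : ℕ} {a b : ℂ} {f g : Z[X]} (hf : IsHomog c m a f) (hg : IsHomog c m b g) :
    IsHomog c m (a + b) (f + g) := by
  obtain ⟨α, rfl, rfl⟩ := hf
  obtain ⟨β, rfl, rfl⟩ := hg
  refine ⟨α + β, rfl, ?_⟩
  rw [← Finset.sum_add_distrib]
  refine Finset.sum_congr rfl fun j _ => ?_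
  simp only [Pi.add_apply, map_add, add_mul]

theorem IsHomog.neg {m : ℕ} {a : ℂ} {f : Z[X]} (hf : IsHomog c m a f) : IsHomog c m (-a) (-f) := by
  obtain ⟨α, rfl, rfl⟩ := hf
  refine ⟨-α, rfl, ?_⟩
  rw [← Finset.sum_neg_distrib]
  refine Finset.sum_congr rfl fun j _ => ?_
  simp only [Pi.neg_apply, map_neg, neg_mul]

theorem IsHomog.X_mul {m : ℕ} {a : ℂ} {f : Z[X]} (hf : IsHomog c m a f) :
    IsHomog c (m + 1) a (X * f) := by
  obtain ⟨α, rfl, rfl⟩ := hf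
  refine ⟨fun j => if j = 0 then 0 else α (j - 1), by simp, ?_⟩
  rw [Finset.sum_range_succ' _ (m + 1), Finset.mul_sum]
  simp only [Nat.add_sub_add_right, Nat.add_sub_cancel, if_neg (Nat.succ_ne_zero _), if_true,
    map_zero, zero_mul, add_zero]
  refine Finset.sum_congr rfl fun j _ => ?_
  ring

theorem IsHomog.C_mul {m : ℕ} {a : ℂ} {f : Z[X]} (hf : IsHomog c m a f) :
    IsHomog c (m + 1) 0 (C c * f) := by
  obtain ⟨α, rfl, rfl⟩ := hf
  refine ⟨fun j => if j ≤ m then α j else 0, by simp, ?_⟩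
  rw [Finset.sum_range_succ _ (m + 1), Finset.mul_sum]
  simp only [if_neg (show ¬ m + 1 ≤ m by omega), map_zero, zero_mul, add_zero]
  refine Finset.sum_congr rfl fun j hj => ?_
  rw [Finset.mem_range] at hj
  rw [if_pos (by omega), show m + 1 - j = m - j + 1 by omega, pow_succ, ← mul_assoc, ← Polynomial.C_mul]
  congr 2
  ring

theorem isHomog_X_sub_C_pow (m : ℕ) : IsHomog c m 1 ((X - C c) ^ m) := by
  induction m with
  | zero => simpa using isHomog_one
  | succ m ih =>
    have h := ih.X_mul.add ih.C_mul.neg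
    rwa [neg_zero, add_zero, ← sub_eq_add_neg, ← sub_mul, ← pow_succ'] at h

theorem isHomog_C_sub_X_pow (m : ℕ) : IsHomog c m ((-1) ^ m) ((C c - X) ^ m) := by
  induction m with
  | zero => simpa using isHomog_one
  | succ m ih =>
    have h := ih.C_mul.add ih.X_mul.neg
    rwa [zero_add, ← sub_eq_add_neg, ← sub_mul, ← pow_succ', ← neg_one_mul, ← pow_succ'] at h

theorem isHomog_X_pow (m : ℕ) : IsHomog c m 1 (X ^ m) := by
  induction m with
  | zero => simpa using isHomog_one
  | succ m ih => rw [pow_succ']; exact ih.X_mul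

theorem isHomog_diffQuot (k : ℕ) : IsHomog c k (k + 1) (diffQuot c (k + 1)) := by
  induction k with
  | zero => simpa [diffQuot] using isHomog_one
  | succ k ih =>
    have h := ih.X_mul.add (isHomog_X_sub_C_pow (c := c) (k + 1))
    rw [diffQuot]
    convert h using 1
    push_cast
    ring

theorem IsHomog.twist {m : ℕ} {a : ℂ} {f : Z[X]} (hf : IsHomog c m a f) (n q : Z) :
    ∃ α : ℕ → ℂ, α m = a ∧ GL11.twist c n q f = ∑ j ∈ Finset.range (m + 1),
      algebraMap ℂ Z (α j) * c ^ (m - j) * GL11.twist c n q (X ^ j) := by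
  obtain ⟨α, rfl, rfl⟩ := hf
  refine ⟨α, rfl, ?_⟩
  rw [map_sum]
  refine Finset.sum_congr rfl fun j _ => ?_
  rw [← smul_eq_C_mul, map_smul, smul_eq_mul]

end Homog

/-! ### The three families in a ring -/

theorem Family.map_expr {A B : Type} [Ring A] [Ring B] (φ : A →+* B) (F : Family)
    (e : Fin 2 → Fin 2 → A) (k : ℕ) : φ (F.expr e k) = F.expr (fun i j => φ (e i j)) k := by
  cases F with
  | h => simp [Family.expr]
  | b => simp [Family.expr]
  | s =>
    have hM : !![φ (e 0 0), φ (e 0 1); -φ (e 1 0), -φ (e 1 1)] =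
        φ.mapMatrix !![e 0 0, e 0 1; -e 1 0, -e 1 1] := by
      ext i j
      fin_cases i <;> fin_cases j <;> simp
    simp only [Family.expr, hM, ← map_pow, map_sub]
    rfl

/-- The relations between the matrix entries: the even ones and the product of the odd ones are
central, the odd ones anticommute. -/
structure SuperArray {A : Type} [Ring A] [Algebra ℂ A] (e : Fin 2 → Fin 2 → A) : Prop where
  central_zero : e 0 0 ∈ Subalgebra.center ℂ A
  central_one : e 1 1 ∈ Subalgebra.center ℂ A
  central_mul : e 1 0 * e 0 1 ∈ Subalgebra.center ℂ A
  anticomm : e 0 1 * e 1 0 = -(e 1 0 * e 0 1)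
  sq_zero_one : e 0 1 * e 0 1 = 0
  sq_one_zero : e 1 0 * e 1 0 = 0

namespace SuperArray

variable {A : Type} [Ring A] [Algebra ℂ A] {e : Fin 2 → Fin 2 → A}

open Polynomial

variable {Z : Type*} [CommRing Z] [Algebra ℂ Z]

/-- The powers of the matrix of the family `s`. The commutative ring `Z` with its central
homomorphism `φ` makes polynomial identities in the central elements available. -/
theorem matrix_pow (φ : Z →ₐ[ℂ] A) (hφ : ∀ z u, φ z * u = u * φ z) (he : SuperArray e) {c n : Z}
    (hn : φ n = e 0 0) (hc : φ c = e 0 0 + e 1 1) (k : ℕ) :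
    !![e 0 0, e 0 1; -e 1 0, -e 1 1] ^ k =
      !![φ (n ^ k) + e 1 0 * e 0 1 * φ (traceA c n k), e 0 1 * φ ((diffQuot c k).eval n);
        -(e 1 0 * φ ((diffQuot c k).eval n)),
          φ ((n - c) ^ k) - e 1 0 * e 0 1 * φ (traceB c n k)] := by
  have hl : -e 1 1 = φ (n - c) := by
    rw [map_sub, hn, hc]; abel
  have h1 : e 1 0 * e 0 1 * e 0 1 = 0 := by rw [mul_assoc, he.sq_zero_one, mul_zero]
  have h2 : e 1 0 * e 0 1 * e 1 0 = 0 := by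
    rw [mul_assoc, he.anticomm, mul_neg, ← mul_assoc, he.sq_one_zero, zero_mul, neg_zero]
  rw [hl, ← hn]
  induction k with
  | zero =>
    ext i j
    fin_cases i <;> fin_cases j <;> simp [traceA, traceB, diffQuot]
  | succ k ih =>
    rw [pow_succ, ih, Matrix.mul_fin_two]
    ext i j
    fin_cases i <;> fin_cases j
    · change (φ (n ^ k) + e 1 0 * e 0 1 * φ (traceA c n k)) * φ n +
        e 0 1 * φ ((diffQuot c k).eval n) * -e 1 0 =
          φ (n ^ (k + 1)) + e 1 0 * e 0 1 * φ (traceA c n (k + 1))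
      rw [mul_assoc (e 0 1), hφ, ← mul_assoc (e 0 1), mul_neg, he.anticomm, neg_neg, traceA,
        pow_succ, mul_comm n (traceA c n k)]
      simp only [map_add, map_mul, mul_add, add_mul, mul_assoc, add_assoc]
    · change (φ (n ^ k) + e 1 0 * e 0 1 * φ (traceA c n k)) * e 0 1 +
        e 0 1 * φ ((diffQuot c k).eval n) * φ (n - c) = e 0 1 * φ ((diffQuot c (k + 1)).eval n)
      rw [eval_diffQuot_succ', add_mul, mul_assoc (e 1 0 * e 0 1), hφ (traceA c n k),
        ← mul_assoc (e 1 0 * e 0 1), h1, zero_mul, add_zero, hφ (n ^ k), mul_comm (n - c), map_add,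
        map_mul, mul_add, mul_assoc, add_comm]
    · change -(e 1 0 * φ ((diffQuot c k).eval n)) * φ n +
        (φ ((n - c) ^ k) - e 1 0 * e 0 1 * φ (traceB c n k)) * -e 1 0 =
          -(e 1 0 * φ ((diffQuot c (k + 1)).eval n))
      rw [eval_diffQuot_succ, mul_neg, sub_mul, mul_assoc (e 1 0 * e 0 1), hφ (traceB c n k),
        ← mul_assoc (e 1 0 * e 0 1), h2, zero_mul, sub_zero, hφ ((n - c) ^ k), mul_comm n, map_add,
        map_mul, mul_add, neg_mul, neg_add, mul_assoc]
    · change -(e 1 0 * φ ((diffQuot c k).eval n)) * e 0 1 +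
        (φ ((n - c) ^ k) - e 1 0 * e 0 1 * φ (traceB c n k)) * φ (n - c) =
          φ ((n - c) ^ (k + 1)) - e 1 0 * e 0 1 * φ (traceB c n (k + 1))
      rw [neg_mul, mul_assoc (e 1 0), hφ, ← mul_assoc (e 1 0), traceB, pow_succ,
        mul_comm (n - c) (traceB c n k)]
      simp only [map_add φ, map_mul, mul_add, sub_mul, mul_assoc]
      abel

/-- The three families are the values of `twist` at `X^k`, `(c - X)^k` and
`(X^(k+1) - (X-c)^(k+1)) / c`. -/
theorem expr_eq_twist (φ : Z →ₐ[ℂ] A) (hφ : ∀ z u, φ z * u = u * φ z) (he : SuperArray e)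
    (F : Family) {c n q : Z} (hn : φ n = e 0 0) (hc : φ c = e 0 0 + e 1 1)
    (hq : φ q = e 1 0 * e 0 1) (k : ℕ) :
    F.expr e (k + 1) = φ (twist c n q (match F with
      | .h => X ^ k
      | .b => (C c - X) ^ k
      | .s => diffQuot c (k + 1))) := by
  have hk : e 1 1 = φ (c - n) := by
    rw [map_sub, hn, hc]; abel
  cases F with
  | h =>
    change e 0 0 ^ k * (e 0 0 + e 1 1) + k • (e 0 0 ^ (k - 1) * e 1 0 * e 0 1) = _
    rw [mul_assoc, ← hc, ← hq, ← hn, twist_X_pow]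
    simp
  | b =>
    change e 1 1 ^ k * (e 0 0 + e 1 1) - k • (e 1 1 ^ (k - 1) * e 1 0 * e 0 1) = _
    rw [mul_assoc, ← hc, ← hq, hk, twist_C_sub_X_pow]
    simp
  | s =>
    rw [twist_diffQuot, Family.expr, he.matrix_pow φ hφ hn hc, ← hq]
    simp [mul_add]
    abel

/-- Each family is a triangular homogeneous combination of the family `h`. -/
theorem exists_expr_eq_sum (he : SuperArray e) (F : Family) (k : ℕ) :
    ∃ α : ℕ → ℂ, α k ≠ 0 ∧ F.expr e (k + 1) = ∑ j ∈ Finset.range (k + 1),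
      α j • ((e 0 0 + e 1 1) ^ (k - j) * Family.h.expr e (j + 1)) := by
  let φ := (Subalgebra.center ℂ A).val
  have hφ : ∀ z u, φ z * u = u * φ z := fun z u => (Subalgebra.mem_center_iff.1 z.2 u).symm
  let n : Subalgebra.center ℂ A := ⟨e 0 0, he.central_zero⟩
  let c : Subalgebra.center ℂ A := ⟨e 0 0 + e 1 1, add_mem he.central_zero he.central_one⟩
  let q : Subalgebra.center ℂ A := ⟨e 1 0 * e 0 1, he.central_mul⟩
  have key : ∀ f a, a ≠ 0 → IsHomog c k a f → F.expr e (k + 1) = φ (twist c n q f) →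
      ∃ α : ℕ → ℂ, α k ≠ 0 ∧ F.expr e (k + 1) = ∑ j ∈ Finset.range (k + 1),
        α j • ((e 0 0 + e 1 1) ^ (k - j) * Family.h.expr e (j + 1)) := by
    intro f a ha hf hF
    obtain ⟨α, rfl, hα⟩ := hf.twist n q
    refine ⟨α, ha, ?_⟩
    rw [hF, hα, map_sum]
    refine Finset.sum_congr rfl fun j _ => ?_
    rw [he.expr_eq_twist φ hφ .h (c := c) (n := n) (q := q) rfl rfl rfl, map_mul, map_mul,
      AlgHom.commutes, map_pow, Algebra.smul_def, mul_assoc]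
    rfl
  have hF := he.expr_eq_twist φ hφ F (c := c) (n := n) (q := q) rfl rfl rfl k
  cases F with
  | h => exact key _ 1 one_ne_zero (isHomog_X_pow k) hF
  | b => exact key _ _ (pow_ne_zero k (neg_ne_zero.2 one_ne_zero)) (isHomog_C_sub_X_pow k) hF
  | s => exact key _ _ (Nat.cast_add_one_ne_zero k) (isHomog_diffQuot k) hF

/-- A subalgebra contains one of the families if and only if it contains the family `h`. -/
theorem forall_expr_mem_iff (he : SuperArray e) (F : Family) (B : Subalgebra ℂ A) :
    (∀ k, F.expr e (k + 1) ∈ B) ↔ ∀ k, Family.h.expr e (k + 1) ∈ B := by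
  have hh : Family.h.expr e 1 = e 0 0 + e 1 1 := by simp [Family.expr]
  constructor
  · intro hF k
    have hc : e 0 0 + e 1 1 ∈ B := by
      obtain ⟨α, hα, h⟩ := he.exists_expr_eq_sum F 0
      have h0 := hF 0
      rw [h, Finset.sum_range_one, Nat.sub_zero, pow_zero, one_mul, hh] at h0
      simpa [smul_smul, inv_mul_cancel₀ hα] using B.smul_mem h0 (α 0)⁻¹
    induction k using Nat.strong_induction_on with
    | _ k ih =>
      obtain ⟨α, hα, h⟩ := he.exists_expr_eq_sum F k
      rw [Finset.sum_range_succ, Nat.sub_self, pow_zero, one_mul] at h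
      have hk : α k • Family.h.expr e (k + 1) ∈ B := by
        rw [eq_sub_of_add_eq' h.symm]
        exact B.sub_mem (hF k) (B.sum_mem fun j hj => B.smul_mem (B.mul_mem (B.pow_mem hc _)
          (ih j (Finset.mem_range.1 hj))) _)
      simpa [smul_smul, inv_mul_cancel₀ hα] using B.smul_mem hk (α k)⁻¹
  · intro hF k
    have hc : e 0 0 + e 1 1 ∈ B := hh ▸ hF 0
    obtain ⟨α, _, h⟩ := he.exists_expr_eq_sum F k
    rw [h]
    exact B.sum_mem fun j _ => B.smul_mem (B.mul_mem (B.pow_mem hc _) (hF j)) _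

end SuperArray

end GL11

namespace GL11

open PowerSeries

/-! ### The generating series -/

theorem coeff_complex_smul (c : ℂ) (r : ℕ) (f : PowerSeries SLoop) :
    coeff r (c • f) = c • coeff r f := rfl

theorem coeff_Eser (i j : Fin 2) (r : ℕ) : coeff r (Eser i j) = gen (i, j) r := by
  simp [Eser, gen]

/-- A power series with central coefficients is central. -/
theorem mem_center_of_coeff {A : Type} [Ring A] [Algebra ℂ A] {f : PowerSeries A}
    (hf : ∀ r, coeff r f ∈ Subalgebra.center ℂ A) : f ∈ Subalgebra.center ℂ (PowerSeries A) := by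
  refine Subalgebra.mem_center_iff.2 fun g => PowerSeries.ext fun r => ?_
  rw [coeff_mul, coeff_mul, ← Finset.Nat.sum_antidiagonal_swap]
  exact Finset.sum_congr rfl fun x _ => Subalgebra.mem_center_iff.1 (hf x.1) _

theorem gen_mul_gen_mem_center {c d : Fin 2 × Fin 2} (hc : par c = 1) (hd : par d = 1) (r s : ℕ) :
    gen c r * gen d s ∈ Subalgebra.center ℂ SLoop := by
  refine Subalgebra.mem_center_iff.2 fun u => ?_
  induction u using SSym.induction_mul with
  | one => simp
  | ι_mul x u hu =>
    have h1 : gen d s * SSym.ι parLoop x =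
        koszul 1 (parLoop x) • (SSym.ι parLoop x * gen d s) := by
      rw [← hd]
      exact SSym.ι_mul_ι (p := parLoop) (d, s) x
    have h2 : gen c r * SSym.ι parLoop x =
        koszul 1 (parLoop x) • (SSym.ι parLoop x * gen c r) := by
      rw [← hc]
      exact SSym.ι_mul_ι (p := parLoop) (c, r) x
    have hk : koszul 1 (parLoop x) * koszul 1 (parLoop x) = 1 := by
      unfold koszul
      split_ifs <;> norm_num
    have h3 : gen c r * gen d s * SSym.ι parLoop x = SSym.ι parLoop x * (gen c r * gen d s) := by
      rw [mul_assoc, h1, mul_smul_comm, ← mul_assoc, h2, smul_mul_assoc, smul_smul, hk, one_smul,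
        mul_assoc]
    rw [← mul_assoc _ _ u, h3, mul_assoc, mul_assoc, hu]
  | add u v hu hv => rw [add_mul, mul_add, hu, hv]
  | smul c u hu => rw [smul_mul_assoc, mul_smul_comm, hu]

theorem gen_anticomm {c d : Fin 2 × Fin 2} (hc : par c = 1) (hd : par d = 1) (r s : ℕ) :
    gen c r * gen d s = -(gen d s * gen c r) := by
  have h := SSym.ι_mul_ι (p := parLoop) (c, r) (d, s)
  change gen c r * gen d s = koszul (par c) (par d) • (gen d s * gen c r) at h
  rw [h, hc, hd, koszul_one_one, neg_smul, one_smul]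

theorem Eser_anticomm {i j k l : Fin 2} (hc : par (i, j) = 1) (hd : par (k, l) = 1) :
    Eser i j * Eser k l = -(Eser k l * Eser i j) := by
  refine PowerSeries.ext fun r => ?_
  rw [map_neg, coeff_mul, coeff_mul, ← Finset.Nat.sum_antidiagonal_swap, ← Finset.sum_neg_distrib]
  refine Finset.sum_congr rfl fun x _ => ?_
  rw [coeff_Eser, coeff_Eser, coeff_Eser, coeff_Eser]
  exact gen_anticomm hc hd _ _

theorem eq_zero_of_eq_neg {A : Type} [AddCommGroup A] [Module ℂ A] {x : A} (h : x = -x) :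
    x = 0 := by
  have h2 : (2 : ℂ) • x = 0 := by
    rw [two_smul]
    nth_rewrite 1 [h]
    exact neg_add_cancel x
  exact (smul_eq_zero.1 h2).resolve_left two_ne_zero

theorem superArray_Eser : SuperArray Eser where
  central_zero := mem_center_of_coeff fun r => by
    rw [coeff_Eser]; exact gen_mem_center par_zero_zero r
  central_one := mem_center_of_coeff fun r => by
    rw [coeff_Eser]; exact gen_mem_center par_one_one r
  central_mul := mem_center_of_coeff fun r => by
    rw [coeff_mul]
    refine Subalgebra.sum_mem _ fun x _ => ?_
    rw [coeff_Eser, coeff_Eser]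
    exact gen_mul_gen_mem_center par_one_zero par_zero_one _ _
  anticomm := Eser_anticomm par_zero_one par_one_zero
  sq_zero_one := eq_zero_of_eq_neg (Eser_anticomm par_zero_one par_zero_one)
  sq_one_zero := eq_zero_of_eq_neg (Eser_anticomm par_one_zero par_one_zero)

/-! ### Invariance -/

/-- The action of `E_a[s]` on power series, coefficient by coefficient. -/
noncomputable def actSeries (a : Fin 2 × Fin 2) (s : ℕ) (f : PowerSeries SLoop) :
    PowerSeries SLoop := PowerSeries.mk fun r => act a s (coeff r f)

theorem coeff_actSeries (a : Fin 2 × Fin 2) (s r : ℕ) (f : PowerSeries SLoop) :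
    coeff r (actSeries a s f) = act a s (coeff r f) := by
  simp [actSeries]

theorem actSeries_add (a : Fin 2 × Fin 2) (s : ℕ) (f g : PowerSeries SLoop) :
    actSeries a s (f + g) = actSeries a s f + actSeries a s g := by
  ext r; simp [coeff_actSeries]

theorem actSeries_nsmul (a : Fin 2 × Fin 2) (s m : ℕ) (f : PowerSeries SLoop) :
    actSeries a s (m • f) = m • actSeries a s f := by
  ext r; simp only [coeff_actSeries, map_nsmul]

theorem act_gen (a : Fin 2 × Fin 2) (s : ℕ) (c : Fin 2 × Fin 2) (r : ℕ) :
    act a s (gen c r) = adLoop (a, s) (c, r) :=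
  SSym.superDer_ι (p := parLoop) _ _ _ _

/-- `E_a[s] E_c(z) = z^s [E_a, E_c](z)`. -/
theorem actSeries_Eser (a : Fin 2 × Fin 2) (s : ℕ) (i j : Fin 2) :
    actSeries a s (Eser i j) = X ^ s * ∑ d : Fin 2 × Fin 2,
      bracket a (i, j) d.1 d.2 • Eser d.1 d.2 := by
  ext r
  rw [coeff_actSeries, coeff_Eser, coeff_X_pow_mul', act_gen]
  split_ifs with h
  · obtain ⟨b, rfl⟩ := Nat.exists_eq_add_of_le' h
    rw [adLoop_eq_sum, Nat.add_sub_cancel, map_sum]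
    exact Finset.sum_congr rfl fun d _ => by rw [coeff_complex_smul, coeff_Eser]
  · exact adLoop_of_lt (not_le.1 h)

theorem actSeries_Eser_mul (a : Fin 2 × Fin 2) (s : ℕ) (i j : Fin 2) (f : PowerSeries SLoop) :
    actSeries a s (Eser i j * f) = actSeries a s (Eser i j) * f +
      koszul (par a) (par (i, j)) • (Eser i j * actSeries a s f) := by
  ext r
  rw [map_add, coeff_complex_smul, coeff_actSeries, coeff_mul, coeff_mul, coeff_mul, map_sum,
    Finset.smul_sum, ← Finset.sum_add_distrib]
  refine Finset.sum_congr rfl fun x _ => ?_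
  rw [coeff_actSeries, coeff_actSeries, coeff_Eser, act_gen_mul, act_gen]

theorem Eser_comm {i j : Fin 2} (hc : par (i, j) = 0) (f : PowerSeries SLoop) :
    Eser i j * f = f * Eser i j :=
  (Subalgebra.mem_center_iff.1 (mem_center_of_coeff fun r => by
    rw [coeff_Eser]; exact gen_mem_center hc r) f).symm

theorem actSeries_Eser_pow_mul (a : Fin 2 × Fin 2) (s m : ℕ) (f : PowerSeries SLoop) :
    actSeries a s (Eser 0 0 ^ m * f) = Eser 0 0 ^ m * actSeries a s f +
      m • (Eser 0 0 ^ (m - 1) * (actSeries a s (Eser 0 0) * f)) := by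
  have hc : ∀ u, Eser 0 0 * u = u * Eser 0 0 := fun u => Eser_comm par_zero_zero u
  induction m with
  | zero => simp
  | succ m ih =>
    rw [pow_succ', mul_assoc, actSeries_Eser_mul, ih, par_zero_zero, koszul_zero_right, one_smul,
      Nat.add_sub_cancel]
    have h1 : actSeries a s (Eser 0 0) * (Eser 0 0 ^ m * f) =
        Eser 0 0 ^ m * (actSeries a s (Eser 0 0) * f) := by
      rw [← mul_assoc, ← mul_assoc, (Commute.pow_left (hc _ : Commute _ _) m).eq]
    have h2 : Eser 0 0 * (m • (Eser 0 0 ^ (m - 1) * (actSeries a s (Eser 0 0) * f))) =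
        m • (Eser 0 0 ^ m * (actSeries a s (Eser 0 0) * f)) := by
      rcases m with _ | m
      · simp
      · rw [mul_smul_comm, Nat.add_sub_cancel, ← mul_assoc, ← pow_succ']
    rw [h1, mul_add, h2, succ_nsmul, mul_assoc]
    abel

set_option linter.unusedSimpArgs false in
/-- `C(z)` is invariant, and `E_21(z) E_12(z)` varies by `-C(z)` times the variation of `E_11(z)`. -/
theorem actSeries_relations (a : Fin 2 × Fin 2) (s : ℕ) :
    actSeries a s (Eser 0 0 + Eser 1 1) = 0 ∧
    actSeries a s (Eser 0 0) * (Eser 1 0 * Eser 0 1) = 0 ∧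
    actSeries a s (Eser 1 0 * Eser 0 1) = -(actSeries a s (Eser 0 0) * (Eser 0 0 + Eser 1 1)) := by
  have h1 : Eser 1 0 * Eser 1 0 = 0 := superArray_Eser.sq_one_zero
  have h2 : Eser 0 1 * Eser 0 1 = 0 := superArray_Eser.sq_zero_one
  have h3 : Eser 0 1 * (Eser 1 0 * Eser 0 1) = 0 := by
    rw [← mul_assoc, superArray_Eser.anticomm, neg_mul, mul_assoc, h2, mul_zero, neg_zero]
  have h4 : Eser 1 0 * (Eser 1 0 * Eser 0 1) = 0 := by rw [← mul_assoc, h1, zero_mul]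
  have hX : ∀ f g : PowerSeries SLoop, f * (X ^ s * g) = X ^ s * (f * g) := fun f g => by
    rw [← mul_assoc, ← mul_assoc, X_pow_mul]
  have hC : ∀ f, f * (Eser 0 0 + Eser 1 1) = (Eser 0 0 + Eser 1 1) * f := fun f => by
    rw [mul_add, add_mul, Eser_comm par_zero_zero, Eser_comm par_one_one]
  rw [actSeries_add, actSeries_Eser_mul]
  simp only [actSeries_Eser, Fintype.sum_prod_type, Fin.sum_univ_two]
  rcases index_cases a with rfl | rfl | rfl | rfl
  · refine ⟨?_, ?_, ?_⟩
    · simp [bracket, koszul, par_zero_zero, par_zero_one, par_one_zero, par_one_one]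
    · simp [bracket, koszul, par_zero_zero, par_zero_one, par_one_zero, par_one_one]
    · simp [bracket, koszul, par_zero_zero, par_zero_one, par_one_zero, par_one_one]
      rw [hX, mul_assoc, neg_add_cancel]
  · refine ⟨?_, ?_, ?_⟩
    · simp [bracket, koszul, par_zero_zero, par_zero_one, par_one_zero, par_one_one]
    · simp [bracket, koszul, par_zero_zero, par_zero_one, par_one_zero, par_one_one]
      rw [mul_assoc, h3, mul_zero]
    · simp [bracket, koszul, par_zero_zero, par_zero_one, par_one_zero, par_one_one]
      rw [mul_assoc, mul_assoc, hC]
  · refine ⟨?_, ?_, ?_⟩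
    · simp [bracket, koszul, par_zero_zero, par_zero_one, par_one_zero, par_one_one]
    · simp [bracket, koszul, par_zero_zero, par_zero_one, par_one_zero, par_one_one]
      rw [mul_assoc, h4, mul_zero]
    · simp [bracket, koszul, par_zero_zero, par_zero_one, par_one_zero, par_one_one]
      rw [hX, mul_assoc]
  · refine ⟨?_, ?_, ?_⟩
    · simp [bracket, koszul, par_zero_zero, par_zero_one, par_one_zero, par_one_one]
    · simp [bracket, koszul, par_zero_zero, par_zero_one, par_one_zero, par_one_one]
    · simp [bracket, koszul, par_zero_zero, par_zero_one, par_one_zero, par_one_one]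
      rw [hX, mul_assoc, add_neg_cancel]

/-- The variations of the two terms of `h_k(z)` cancel. -/
theorem actSeries_h (a : Fin 2 × Fin 2) (s k : ℕ) :
    actSeries a s (Family.h.expr Eser (k + 1)) = 0 := by
  obtain ⟨h1, h2, h3⟩ := actSeries_relations a s
  change actSeries a s (Eser 0 0 ^ k * (Eser 0 0 + Eser 1 1) +
    k • (Eser 0 0 ^ (k - 1) * Eser 1 0 * Eser 0 1)) = 0
  rw [actSeries_add, actSeries_nsmul, mul_assoc, actSeries_Eser_pow_mul, actSeries_Eser_pow_mul, h1,
    h2, h3, mul_zero, mul_zero, smul_zero, zero_add, add_zero, mul_neg, smul_neg, add_neg_cancel]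

theorem coeff_h_mem_invLoop (k r : ℕ) : coeff r (Family.h.expr Eser (k + 1)) ∈ invLoop := by
  rw [mem_invLoop_iff]
  intro a s
  rw [← coeff_actSeries, actSeries_h, map_zero]

/-! ### Generators of the invariants of the loop algebra -/

/-- The power series with coefficients in a subalgebra. -/
noncomputable def coeffSubalgebra {A : Type} [Ring A] [Algebra ℂ A] (B : Subalgebra ℂ A) :
    Subalgebra ℂ (PowerSeries A) where
  carrier := {f | ∀ r, coeff r f ∈ B}
  mul_mem' {f g} hf hg r := by
    rw [coeff_mul]
    exact B.sum_mem fun x _ => B.mul_mem (hf _) (hg _)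
  add_mem' {f g} hf hg r := by
    rw [map_add]
    exact B.add_mem (hf r) (hg r)
  algebraMap_mem' c r := by
    rw [PowerSeries.algebraMap_apply, coeff_C]
    split_ifs
    · exact B.algebraMap_mem c
    · exact B.zero_mem

/-- The algebra generated by the coefficients of the series of a family. -/
noncomputable def seriesAlg (F : Family) : Subalgebra ℂ SLoop :=
  Algebra.adjoin ℂ {x | ∃ k : ℕ, 1 ≤ k ∧ ∃ r : ℕ, x = coeff r (F.expr Eser k)}

theorem coeff_mem_seriesAlg (F : Family) (k r : ℕ) :
    coeff r (F.expr Eser (k + 1)) ∈ seriesAlg F :=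
  Algebra.subset_adjoin ⟨k + 1, Nat.le_add_left 1 k, r, rfl⟩

theorem seriesAlg_le_iff (F : Family) (B : Subalgebra ℂ SLoop) :
    seriesAlg F ≤ B ↔ ∀ k, F.expr Eser (k + 1) ∈ coeffSubalgebra B := by
  rw [seriesAlg, Algebra.adjoin_le_iff]
  constructor
  · exact fun h k r => h ⟨k + 1, Nat.le_add_left 1 k, r, rfl⟩
  · rintro h x ⟨k, hk, r, rfl⟩
    obtain ⟨k, rfl⟩ := Nat.exists_eq_add_of_le' hk
    exact h k r

theorem seriesAlg_eq (F : Family) : seriesAlg F = seriesAlg .h := by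
  refine le_antisymm ?_ ?_
  · rw [seriesAlg_le_iff, superArray_Eser.forall_expr_mem_iff]
    exact fun k r => coeff_mem_seriesAlg .h k r
  · rw [seriesAlg_le_iff, ← superArray_Eser.forall_expr_mem_iff F]
    exact fun k r => coeff_mem_seriesAlg F k r

theorem restr_coeff_h (k r : ℕ) :
    restr (coeff r (Family.h.expr Eser (k + 1))) = coeff r (Cser * Nser ^ k) := by
  have hmap : ∀ i j, PowerSeries.map (restr : SLoop →+* Jet) (Eser i j) =
      PowerSeries.mk fun r => restr (gen (i, j) r) := fun i j => by
    ext r; simp [coeff_Eser]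
  have h := Family.map_expr (PowerSeries.map (restr : SLoop →+* Jet)) .h Eser (k + 1)
  have h0 : PowerSeries.map (restr : SLoop →+* Jet) (Eser 0 0) = Nser := by
    rw [hmap]; simp only [restr_gen_zero_zero]; rfl
  have h1 : PowerSeries.map (restr : SLoop →+* Jet) (Eser 1 1) = Cser - Nser := by
    rw [hmap]; ext r; simp [restr_gen_one_one, Cser, Nser]
  have h2 : PowerSeries.map (restr : SLoop →+* Jet) (Eser 0 1) = 0 := by
    rw [hmap]; ext r; simp [restr_gen_of_odd par_zero_one]
  have h3 := congrArg (coeff r) h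
  rw [coeff_map] at h3
  refine h3.trans ?_
  simp only [Family.expr, h0, h1, h2, mul_zero, smul_zero, add_zero, Nat.add_sub_cancel,
    add_sub_cancel]
  rw [mul_comm]

/-- The coefficients of the series of each family generate the invariants: the restriction to the
even part is injective on invariants, and its image is generated by the `C(z) N(z)^k`. -/
theorem seriesAlg_eq_invLoop (F : Family) : seriesAlg F = invLoop := by
  rw [seriesAlg_eq]
  have hle : seriesAlg .h ≤ invLoop := by
    rw [seriesAlg_le_iff]
    exact fun k r => coeff_h_mem_invLoop k r
  refine le_antisymm hle fun u hu => ?_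
  have hjet : jetAlg ≤ (seriesAlg .h).map restr := by
    refine Algebra.adjoin_le ?_
    rintro _ ⟨k, m, rfl⟩
    exact ⟨_, coeff_mem_seriesAlg .h k m, restr_coeff_h k m⟩
  obtain ⟨v, hv, huv⟩ := hjet (firstOrder_restr hu).mem_jetAlg
  have h0 : u - v = 0 := eq_zero_of_restr_eq_zero (invLoop.sub_mem hu (hle hv)) (by
    rw [map_sub, sub_eq_zero]; exact huv.symm)
  rw [sub_eq_zero.1 h0]
  exact hv

/-! ### The translation operator -/

theorem T_gen (c : Fin 2 × Fin 2) (r : ℕ) : T (gen c r) = ((r : ℂ) + 1) • gen c (r + 1) :=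
  SSym.superDer_ι (p := parLoop) _ _ _ _

theorem signAut_zero {X : Type} (p : X → ZMod 2) (u : SSym p) : SSym.signAut p 0 u = u := by
  have h : SSym.signAut p 0 = AlgHom.id ℂ (SSym p) :=
    SSym.hom_ext fun x => by simp [SSym.signAut, koszul_zero_left]
  rw [h, AlgHom.id_apply]

theorem T_mul (u v : SLoop) : T (u * v) = T u * v + u * T v := by
  have h := SSym.superDer_mul (p := parLoop) 0 (fun x => ((x.2 : ℂ) + 1) •
    SSym.ι parLoop (x.1, x.2 + 1)) (fun x => Submodule.smul_mem _ _
      (Submodule.subset_span ⟨(x.1, x.2 + 1), (add_zero _).symm, rfl⟩)) u v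
  rwa [signAut_zero] at h

/-- The power series on whose coefficients `T` acts as `d/dz`. -/
noncomputable def translationSubalgebra : Subalgebra ℂ (PowerSeries SLoop) where
  carrier := {f | ∀ r, T (coeff r f) = ((r : ℂ) + 1) • coeff (r + 1) f}
  mul_mem' {f g} hf hg r := by
    -- Split the factor `r + 1` as the sum of the two degrees in each product.
    have hsplit : ((r : ℂ) + 1) • coeff (r + 1) (f * g) =
        ∑ x ∈ Finset.HasAntidiagonal.antidiagonal (r + 1), (x.1 : ℂ) • (coeff x.1 f * coeff x.2 g) +
          ∑ x ∈ Finset.HasAntidiagonal.antidiagonal (r + 1),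
            (x.2 : ℂ) • (coeff x.1 f * coeff x.2 g) := by
      rw [coeff_mul, Finset.smul_sum, ← Finset.sum_add_distrib]
      refine Finset.sum_congr rfl fun x hx => ?_
      rw [← add_smul, ← Nat.cast_add, Finset.HasAntidiagonal.mem_antidiagonal.1 hx, Nat.cast_succ]
    rw [hsplit, Finset.Nat.sum_antidiagonal_succ, Finset.Nat.sum_antidiagonal_succ', coeff_mul,
      map_sum]
    simp only [Nat.cast_zero, zero_smul, zero_add, Nat.cast_succ]
    rw [← Finset.sum_add_distrib]
    refine Finset.sum_congr rfl fun x _ => ?_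
    rw [T_mul, hf, hg, smul_mul_assoc, mul_smul_comm]
  add_mem' {f g} hf hg r := by
    rw [map_add, map_add, map_add, hf r, hg r, smul_add]
  algebraMap_mem' c r := by
    rw [PowerSeries.algebraMap_apply, coeff_C, coeff_C, if_neg (Nat.succ_ne_zero r), smul_zero]
    split_ifs
    · exact SSym.superDer_algebraMap _ _ _ c
    · exact map_zero _

end GL11

namespace GL11

open PowerSeries

theorem Eser_mem_translationSubalgebra (i j : Fin 2) : Eser i j ∈ translationSubalgebra :=
  fun r => by rw [coeff_Eser, coeff_Eser, T_gen]

theorem expr_Eser_mem_translationSubalgebra (F : Family) (k : ℕ) :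
    F.expr Eser k ∈ translationSubalgebra := by
  have h := Family.map_expr translationSubalgebra.val.toRingHom F
    (fun i j => ⟨Eser i j, Eser_mem_translationSubalgebra i j⟩) k
  have h' := (F.expr (fun i j =>
    (⟨Eser i j, Eser_mem_translationSubalgebra i j⟩ : translationSubalgebra)) k).2
  rwa [show ((F.expr (fun i j => (⟨Eser i j, Eser_mem_translationSubalgebra i j⟩ :
    translationSubalgebra)) k : translationSubalgebra) : PowerSeries SLoop) = F.expr Eser k from h]
    at h'

theorem emb_E (i j : Fin 2) : emb (E i j) = gen (i, j) 0 :=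
  SSym.lift_ι _ _ _

/-- `ι(x_k)` is the constant term of `x_k(z)`. -/
theorem emb_expr (F : Family) (k : ℕ) : emb (F.expr E k) = coeff 0 (F.expr Eser k) := by
  have h1 := Family.map_expr (emb : Sg →+* SLoop) F E k
  have h2 := Family.map_expr (constantCoeff (R := SLoop)) F Eser k
  have h3 : (fun i j => (emb : Sg →+* SLoop) (E i j)) =
      fun i j => constantCoeff (R := SLoop) (Eser i j) := by
    funext i j
    rw [← coeff_zero_eq_constantCoeff_apply, coeff_Eser]
    exact emb_E i j
  rw [coeff_zero_eq_constantCoeff_apply, h2, ← h3]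
  exact h1

theorem T_iterate_emb_expr (F : Family) (k r : ℕ) :
    T^[r] (emb (F.expr E k)) = (r.factorial : ℂ) • coeff r (F.expr Eser k) := by
  induction r with
  | zero => simp [emb_expr]
  | succ r ih =>
    rw [Function.iterate_succ_apply', ih, map_smul, expr_Eser_mem_translationSubalgebra F k r,
      smul_smul, Nat.factorial_succ, Nat.cast_mul, Nat.cast_succ, mul_comm]

/-! ### The invariants of the finite-dimensional algebra -/

/-- The left inverse of the embedding `emb`, which sets `E_ij[-r-1]` to zero for `r > 0`. -/
noncomputable def retr : SLoop →ₐ[ℂ] Sg :=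
  SSym.lift (fun x => if x.2 = 0 then SSym.ι par x.1 else 0) (fun x y => by
    split_ifs
    · exact SSym.ι_mul_ι _ _
    all_goals simp)

theorem retr_gen (c : Fin 2 × Fin 2) (r : ℕ) :
    retr (gen c r) = if r = 0 then SSym.ι par c else 0 :=
  SSym.lift_ι _ _ _

theorem retr_emb (u : Sg) : retr (emb u) = u := by
  have h : retr.comp emb = AlgHom.id ℂ Sg := SSym.hom_ext fun c => by
    change retr (emb (E c.1 c.2)) = _
    rw [emb_E, retr_gen, if_pos rfl, AlgHom.id_apply]
  exact AlgHom.congr_fun h u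

/-- On `S(g)` the current `E_a[s]` acts as `E_a` if `s = 0`, and by zero otherwise. -/
theorem act_emb (a : Fin 2 × Fin 2) (s : ℕ) (u : Sg) :
    act a s (emb u) = if s = 0 then emb (SSym.superDer (par a) (adg a) (adg_mem a) u) else 0 := by
  induction u using SSym.induction_mul with
  | one => simp [act, SSym.superDer_one]
  | ι_mul c u hu =>
    have hc : emb (SSym.ι par c) = gen c 0 := emb_E c.1 c.2
    rw [map_mul, hc, act_gen_mul, hu, SSym.superDer_ι_mul]
    split_ifs with h
    · subst h
      rw [map_add, map_smul, map_mul, map_mul, hc]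
      congr 2
      rw [← Nat.zero_add 0, adLoop_eq_sum, adg, map_sum]
      exact Finset.sum_congr rfl fun d _ => by rw [map_smul]; congr 1; exact (emb_E d.1 d.2).symm
    · rw [adLoop_of_lt (Nat.pos_of_ne_zero h), zero_mul, mul_zero, smul_zero, add_zero]
  | add u v hu hv =>
    rw [map_add, map_add, hu, hv]
    split_ifs
    · rw [map_add, map_add]
    · rw [add_zero]
  | smul c u hu =>
    rw [map_smul, map_smul, hu]
    split_ifs
    · rw [map_smul, map_smul]
    · rw [smul_zero]

theorem mem_invg_iff (u : Sg) : u ∈ invg ↔ emb u ∈ invLoop := by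
  rw [mem_invLoop_iff]
  constructor
  · intro h a s
    rw [act_emb]
    split_ifs
    · rw [show SSym.superDer (par a) (adg a) (adg_mem a) u = 0 from h a, map_zero]
    · rfl
  · intro h a
    have h' := congrArg retr (h a 0)
    rwa [act_emb, if_pos rfl, retr_emb, map_zero] at h'

theorem retr_coeff_expr (F : Family) (k r : ℕ) :
    retr (coeff r (F.expr Eser k)) = if r = 0 then F.expr E k else 0 := by
  have h1 := Family.map_expr (PowerSeries.map (retr : SLoop →+* Sg)) F Eser k
  have h2 := Family.map_expr (PowerSeries.C (R := Sg)) F E k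
  have h3 : (fun i j => PowerSeries.map (retr : SLoop →+* Sg) (Eser i j)) =
      fun i j => PowerSeries.C (R := Sg) (E i j) := by
    funext i j
    ext m
    rw [coeff_map, coeff_Eser, coeff_C]
    exact retr_gen (i, j) m
  rw [h3, ← h2] at h1
  have h4 := congrArg (coeff r) h1
  rw [coeff_map, coeff_C] at h4
  exact h4

theorem adjoin_expr_E (F : Family) :
    Algebra.adjoin ℂ {x : Sg | ∃ k : ℕ, 1 ≤ k ∧ x = F.expr E k} = invg := by
  refine le_antisymm (Algebra.adjoin_le ?_) fun u hu => ?_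
  · rintro _ ⟨k, hk, rfl⟩
    rw [SetLike.mem_coe, mem_invg_iff, emb_expr, ← seriesAlg_eq_invLoop F]
    exact Algebra.subset_adjoin ⟨k, hk, 0, rfl⟩
  · have hle : seriesAlg F ≤
        (Algebra.adjoin ℂ {x : Sg | ∃ k : ℕ, 1 ≤ k ∧ x = F.expr E k}).comap retr := by
      refine Algebra.adjoin_le ?_
      rintro _ ⟨k, hk, r, rfl⟩
      change retr _ ∈ Algebra.adjoin ℂ _
      rw [retr_coeff_expr]
      split_ifs
      · exact Algebra.subset_adjoin ⟨k, hk, rfl⟩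
      · exact Subalgebra.zero_mem _
    rw [mem_invg_iff, ← seriesAlg_eq_invLoop F] at hu
    have h := hle hu
    rwa [Subalgebra.mem_comap, retr_emb] at h

theorem adjoin_T_iterate (F : Family) :
    Algebra.adjoin ℂ {x : SLoop | ∃ k : ℕ, 1 ≤ k ∧ ∃ r : ℕ, x = T^[r] (emb (F.expr E k))} =
      seriesAlg F := by
  refine le_antisymm (Algebra.adjoin_le ?_) (Algebra.adjoin_le ?_)
  · rintro _ ⟨k, hk, r, rfl⟩
    rw [T_iterate_emb_expr]
    exact Subalgebra.smul_mem _ (Algebra.subset_adjoin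
      (show _ ∈ {x | ∃ k : ℕ, 1 ≤ k ∧ ∃ r : ℕ, x = coeff r (F.expr Eser k)} from ⟨k, hk, r, rfl⟩)) _
  · rintro _ ⟨k, hk, r, rfl⟩
    have h0 : (r.factorial : ℂ) ≠ 0 := Nat.cast_ne_zero.2 r.factorial_ne_zero
    have h : coeff r (F.expr Eser k) = (r.factorial : ℂ)⁻¹ • T^[r] (emb (F.expr E k)) := by
      rw [T_iterate_emb_expr, smul_smul, inv_mul_cancel₀ h0, one_smul]
    rw [h]
    exact Subalgebra.smul_mem _ (Algebra.subset_adjoin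
      (show _ ∈ {x | ∃ k : ℕ, 1 ≤ k ∧ ∃ r : ℕ, x = T^[r] (emb (F.expr E k))} from ⟨k, hk, r, rfl⟩)) _

end GL11

theorem theorem2p1 (F : GL11.Family) :
    Algebra.adjoin ℂ {x : GL11.Sg | ∃ k : ℕ, 1 ≤ k ∧ x = F.expr GL11.E k} = GL11.invg ∧
    (∀ k : ℕ, 1 ≤ k → ∀ r : ℕ,
      GL11.T^[r] (GL11.emb (F.expr GL11.E k)) =
        (r.factorial : ℂ) • PowerSeries.coeff r (F.expr GL11.Eser k)) ∧
    Algebra.adjoin ℂ {x : GL11.SLoop | ∃ k : ℕ, 1 ≤ k ∧ ∃ r : ℕ,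
      x = PowerSeries.coeff r (F.expr GL11.Eser k)} = GL11.invLoop ∧
    Algebra.adjoin ℂ {x : GL11.SLoop | ∃ k : ℕ, 1 ≤ k ∧ ∃ r : ℕ,
      x = GL11.T^[r] (GL11.emb (F.expr GL11.E k))} = GL11.invLoop :=
  ⟨GL11.adjoin_expr_E F, fun k _ r => GL11.T_iterate_emb_expr F k r, GL11.seriesAlg_eq_invLoop F,
    (GL11.adjoin_T_iterate F).trans (GL11.seriesAlg_eq_invLoop F)⟩
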